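/- Let $n \ge 1$. For a function $f:\mathbb{R}^n\to\mathbb{R}$, a bounded set $S\subset\mathbb{R}^n$ with $\operatorname{diam}(S)>0$ and $1\le p<\infty$, put $$\beta_p(S) := \inf_A \left[\frac{1}{\operatorname{diam}(S)^n}\int_S\left(\frac{|f-A|}{\operatorname{diam}(S)}\right)^p d\mathcal{L}^n\right]^{1/p}, \qquad \beta_\infty(S) := \inf_A\sup_{x\in S}\frac{|f(x)-A(x)|}{\operatorname{diam}(S)},$$ where $A$ ranges over all affine maps $\mathbb{R}^n\to\mathbb{R}$. Let $\mathcal{D}$ be the family of standard (half-open) dyadic cubes $\prod_{i=1}^n [k_i2^{-j},(k_i+1)2^{-j})$, $j\in\mathbb{Z}$, $k\in\mathbb{Z}^n$. For $Q\in\mathcal{D}$ let $|Q|$ be its Lebesgue measure and, for $C \ge 1$, let $CQ$ be the concentric (axis-parallel) cube with $\operatorname{diam}(CQ)=C\operatorname{diam}(Q)$. **Theorem (Dorronsoro).** Let $1\le p\le\infty$ if $n=1$, let $1\le p<\infty$ if $n=2$, and let $1\le p<\frac{2n}{n-2}$ if $n\ge 3$. Let $C\ge 1$. Then there is a finite constant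 $K$, depending only on $n$, $p$ and $C$, such that for every $L\ge 0$, every $L$-Lipschitz function $f:\mathbb{R}^n\to\mathbb{R}$ and every $Q_0\in\mathcal{D}$, $$\sum_{Q\in\mathcal{D},\,Q\subset Q_0}\beta_p(CQ)^2\,|Q| \;\le\; K\,L^2\,|Q_0|.$$ -/

import Mathlib

open MeasureTheory
open scoped ENNReal NNReal

noncomputable section

/-- The half-open axis-parallel cube in `ℝⁿ` with centre `c` and side length `s`. -/
def axisCube {n : ℕ} (c : EuclideanSpace ℝ (Fin n)) (s : ℝ) : Set (EuclideanSpace ℝ (Fin n)) :=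
  {x | ∀ i, x i ∈ Set.Ico (c i - s / 2) (c i + s / 2)}

/-- A standard dyadic cube `∏ᵢ [kᵢ 2⁻ʲ, (kᵢ + 1) 2⁻ʲ)` of `ℝⁿ`, recorded by its generation `j ∈ ℤ`
and its position `k ∈ ℤⁿ`. For `n ≥ 1` distinct data give distinct cubes. -/
structure DyadicCube (n : ℕ) where
  gen : ℤ
  pos : Fin n → ℤ

namespace DyadicCube

variable {n : ℕ}

/-- The side length `ℓ(Q) = 2⁻ʲ`. -/
def side (Q : DyadicCube n) : ℝ := (2 : ℝ) ^ (-Q.gen)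

/-- The set of points of the dyadic cube. -/
def toSet (Q : DyadicCube n) : Set (EuclideanSpace ℝ (Fin n)) :=
  {x | ∀ i, x i ∈ Set.Ico ((Q.pos i : ℝ) * Q.side) (((Q.pos i : ℝ) + 1) * Q.side)}

/-- The centre of the dyadic cube. -/
def center (Q : DyadicCube n) : EuclideanSpace ℝ (Fin n) :=
  WithLp.toLp 2 fun i => ((Q.pos i : ℝ) + 1 / 2) * Q.side

/-- The cube `CQ`: concentric with `Q`, with side length `C ℓ(Q)`
(equivalently, with `diam (CQ) = C diam Q`). -/
def dilate (C : ℝ) (Q : DyadicCube n) : Set (EuclideanSpace ℝ (Fin n)) :=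
  axisCube Q.center (C * Q.side)

end DyadicCube

/-- The coefficient `β_p(S)` of `f : ℝⁿ → ℝ` on a bounded set `S`, for `1 ≤ p ≤ ∞`, with values in
`[0, ∞]`: for `p < ∞` it is
`inf_A [ diam(S)⁻ⁿ ∫_S (|f - A| / diam S)ᵖ ]^(1/p)`, and for `p = ∞` it is
`inf_A sup_{x ∈ S} |f(x) - A(x)| / diam S`, where `A` runs over all affine maps `ℝⁿ → ℝ`. -/
def betaNumber {n : ℕ} (f : EuclideanSpace ℝ (Fin n) → ℝ) (p : ℝ≥0∞)
    (S : Set (EuclideanSpace ℝ (Fin n))) : ℝ≥0∞ :=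
  if p = ∞ then
    ⨅ A : EuclideanSpace ℝ (Fin n) →ᵃ[ℝ] ℝ, ⨆ x ∈ S, ‖f x - A x‖ₑ / Metric.ediam S
  else
    ⨅ A : EuclideanSpace ℝ (Fin n) →ᵃ[ℝ] ℝ,
      ((∫⁻ x in S, (‖f x - A x‖ₑ / Metric.ediam S) ^ p.toReal) / Metric.ediam S ^ n) ^
        (1 / p.toReal)

end

/-!
Write `Δ_h f(x) = f (x + h) + f (x - h) - 2 f x` and call a *local mean* at scale `t` the integral of
`|Δ_v f(z)|²` over `|v| ≲ t` and `|z - x| ≲ t`, suitably normalized. The proof bounds `β_p` by local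
means of second differences over all smaller scales, and these are summed without differentiating
`f`.

* *Square function estimate.* The difference quotients of `f` along the steps `2⁻ⁱ v` form a
  martingale-like sequence: each is the mean of two difference quotients with half the step, and by
  the parallelogram law the energy gained in halving the step is that of a second difference. As the
  energies are at most `(L |v|)²` times a volume, `Σ_i ∫ (2ⁱ Δ_{2⁻ⁱ v} f)²` converges; the shifts in
  the base point are absorbed by slightly enlarging the ball at each step
  (`tsum_lintegral_secondDiff_sq_le`). Integration over `v` gives the Carleson estimate
  `tsum_lintegral_secondDiffEnergy_le`.

* *Multiscale bound.* Let `M_t` be the average over balls of radius `t` and `T_t = M_t M_t`. Since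
  balls are symmetric, `M_t f - f` is an average of second differences of `f`. Hence `T_t f` has small
  second differences, so that it is close to an affine function at scale `t`
  (`exists_affineMap_abs_sub_le`), and `T_{t/2} f - T_t f` is small as well; averaging twice makes
  both bounds hold at every point, in terms of local means. Telescoping
  `f = T_ℓ f + Σ_k (T_{ℓ/2^{k+1}} f - T_{ℓ/2^k} f)` gives `exists_affineMap_enorm_sub_sq_le`.

* *Sobolev range.* Passing from `L¹` to `L^{p/2}` costs a local mean at scale `ℓ 2⁻ᵏ` the factor
  `2^{k n (1 - 2/p)}` relative to scale `ℓ`, by Bernstein's inequality for averages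
  (`setLIntegral_ball_rpow_le`). The size of the `k`-th term of the telescoping series gains
  `2^{-2k}`. The net factor is `2^{-k (2 - n + 2 n / p)}`, which for `n ≥ 3` decays precisely when
  `p < 2 n / (n - 2)` (`exists_betaNumber_sq_mul_le`). Exponents `p < 2` reduce to `p = 2` by Hölder's
  inequality.

* *Summation.* Summing the local estimate over the cubes in `Q₀`, with bounded overlap in each
  generation (`DyadicCube.tsum_descendants_setLIntegral_ball_le`) and geometric decay in the difference
  of generations, leaves the Carleson estimate on a dilate of `Q₀`.
-/

/-! ### Second differences and their square function -/

noncomputable section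

open Metric Module ProbabilityTheory

set_option linter.unusedSectionVars false

variable {E : Type*} [NormedAddCommGroup E]

/-- The symmetric second difference `f (x + h) + f (x - h) - 2 f x` with step `h` at `x`. -/
def secondDiff (f : E → ℝ) (h x : E) : ℝ := f (x + h) + f (x - h) - 2 * f x

theorem continuous_secondDiff {f : E → ℝ} (hf : Continuous f) :
    Continuous fun q : E × E => secondDiff f q.1 q.2 := by
  unfold secondDiff
  fun_prop

variable [NormedSpace ℝ E] [FiniteDimensional ℝ E] [MeasureSpace E] [BorelSpace E]
  [(volume : Measure E).IsAddHaarMeasure]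

theorem enorm_sq_eq_ofReal (a : ℝ) : ‖a‖ₑ ^ 2 = ENNReal.ofReal (a ^ 2) := by
  rw [Real.enorm_eq_ofReal_abs, ← ENNReal.ofReal_pow (abs_nonneg a), sq_abs]

theorem setLIntegral_ball_comp_add_right (g : E → ℝ≥0∞) (c h : E) (r : ℝ) :
    ∫⁻ x in ball c r, g (x + h) = ∫⁻ x in ball (c + h) r, g x := by
  have := (measurePreserving_add_right (volume : Measure E) h).setLIntegral_comp_preimage_emb
    (MeasurableEquiv.addRight h).measurableEmbedding g (ball (c + h) r)
  rw [← this]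
  congr 2
  ext x
  simp [dist_eq_norm]

theorem setLIntegral_ball_comp_add_left (g : E → ℝ≥0∞) (c h : E) (r : ℝ) :
    ∫⁻ x in ball c r, g (h + x) = ∫⁻ x in ball (h + c) r, g x := by
  simpa only [add_comm] using setLIntegral_ball_comp_add_right g c h r

theorem setLIntegral_ball_zero_smul (g : E → ℝ≥0∞) {t : ℝ} (ht : 0 < t) (r : ℝ) :
    ∫⁻ v in ball (0 : E) (r * t), g v =
      ENNReal.ofReal (t ^ finrank ℝ E) * ∫⁻ v in ball (0 : E) r, g (t • v) := by
  have hemb : MeasurableEmbedding fun v : E => t • v :=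
    (Homeomorph.smulOfNeZero t ht.ne').measurableEmbedding
  have hpre : (fun v : E => t • v) ⁻¹' ball 0 (r * t) = ball 0 r := by
    ext v
    simp [norm_smul, abs_of_pos ht, mul_comm r t, ht]
  have h2 : ∫⁻ v in ball (0 : E) r, g (t • v) =
      ENNReal.ofReal ((t ^ finrank ℝ E)⁻¹) * ∫⁻ v in ball (0 : E) (r * t), g v := by
    rw [← hpre, ← hemb.lintegral_map, ← hemb.restrict_map,
      Measure.map_addHaar_smul volume ht.ne', Measure.restrict_smul, lintegral_smul_measure,
      abs_of_pos (by positivity), smul_eq_mul]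
  rw [h2, ← mul_assoc, ← ENNReal.ofReal_mul (by positivity), mul_inv_cancel₀ (by positivity),
    ENNReal.ofReal_one, one_mul]

/-- One step of the martingale-type telescoping: by the parallelogram law, the energy of the second
difference is the increase of the energy of the difference quotient when the step is halved. -/
theorem lintegral_diff_sq_add_secondDiff_sq_le {f : E → ℝ} (hf : Continuous f) (c h : E) (r : ℝ) :
    (∫⁻ x in ball c r, ‖f (x + (2 : ℝ) • h) - f x‖ₑ ^ 2) +
        ∫⁻ x in ball c r, ‖secondDiff f h (x + h)‖ₑ ^ 2 ≤
      4 * ∫⁻ x in ball c (r + ‖h‖), ‖f (x + h) - f x‖ₑ ^ 2 := by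
  have hm1 : Measurable fun x => ‖f (x + h) - f x‖ₑ ^ 2 := by fun_prop
  have hm2 : Measurable fun x => ‖f (x + h + h) - f (x + h)‖ₑ ^ 2 := by fun_prop
  have key : ∀ x, ‖f (x + (2 : ℝ) • h) - f x‖ₑ ^ 2 + ‖secondDiff f h (x + h)‖ₑ ^ 2 =
      2 * ‖f (x + h) - f x‖ₑ ^ 2 + 2 * ‖f (x + h + h) - f (x + h)‖ₑ ^ 2 := by
    intro x
    have h2 : (2 : ℝ≥0∞) = ENNReal.ofReal 2 := by simp
    simp only [enorm_sq_eq_ofReal]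
    rw [h2, ← ENNReal.ofReal_mul (by norm_num), ← ENNReal.ofReal_mul (by norm_num),
      ← ENNReal.ofReal_add (by positivity) (by positivity),
      ← ENNReal.ofReal_add (by positivity) (by positivity)]
    congr 1
    rw [secondDiff, add_sub_cancel_right, two_smul, add_assoc]
    ring
  rw [← lintegral_add_left (by fun_prop)]
  simp_rw [key]
  rw [lintegral_add_left (by fun_prop), lintegral_const_mul _ hm1, lintegral_const_mul _ hm2,
    setLIntegral_ball_comp_add_right (fun x => ‖f (x + h) - f x‖ₑ ^ 2)]
  have h4 : (4 : ℝ≥0∞) = 2 + 2 := by norm_num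
  rw [h4, add_mul]
  gcongr
  · linarith [norm_nonneg h]
  · refine ball_subset_ball' ?_
    simp

/-- Square function estimate for second differences along a fixed direction: this is the
dyadic martingale square function estimate for the difference quotients of `f`. -/
theorem tsum_lintegral_secondDiff_sq_le {L : ℝ≥0} {f : E → ℝ} (hf : LipschitzWith L f)
    (c v : E) (R : ℝ) :
    ∑' i : ℕ, ∫⁻ x in ball c R, ‖2 ^ i * secondDiff f (((2 : ℝ) ^ i)⁻¹ • v) x‖ₑ ^ 2 ≤
      (L * ‖(2 : ℝ) • v‖ₑ) ^ 2 * volume (ball c (R + 3 * ‖v‖)) := by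
  have hfc := hf.continuous
  set w : E := (2 : ℝ) • v with hw
  have hwn : ‖w‖ = 2 * ‖v‖ := by simp [hw, norm_smul]
  -- the difference quotients at scale `2⁻ⁱ` on balls which grow with `i`
  let s : ℕ → ℝ := fun i => ((2 : ℝ) ^ i)⁻¹
  have hs : ∀ i, s i = 2 * s (i + 1) := fun i => by simp only [s]; field_simp; ring
  have hspos : ∀ i, 0 < s i := fun i => by positivity
  let r : ℕ → ℝ := fun i => R + ‖v‖ + ‖w‖ * (1 - s i)
  let F : ℕ → ℝ≥0∞ := fun i =>
    4 ^ i * ∫⁻ x in ball c (r i), ‖f (x + s i • w) - f x‖ₑ ^ 2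
  let a : ℕ → ℝ≥0∞ := fun i =>
    ∫⁻ x in ball c R, ‖2 ^ i * secondDiff f (((2 : ℝ) ^ i)⁻¹ • v) x‖ₑ ^ 2
  have hstep : ∀ i, F i + a i ≤ F (i + 1) := by
    intro i
    have h1 := lintegral_diff_sq_add_secondDiff_sq_le hfc c (s (i + 1) • w) (r i)
    rw [smul_smul, ← hs, norm_smul, Real.norm_of_nonneg (hspos _).le] at h1
    have h2 : r i + s (i + 1) * ‖w‖ = r (i + 1) := by
      simp only [r]; rw [hs i]; ring
    rw [h2] at h1
    have h3 : a i ≤ 4 ^ i *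
        ∫⁻ x in ball c (r i), ‖secondDiff f (s (i + 1) • w) (x + s (i + 1) • w)‖ₑ ^ 2 := by
      have hsv : s (i + 1) • w = s i • v := by
        rw [hw, smul_smul, hs i, mul_comm]
      rw [setLIntegral_ball_comp_add_right
        (fun x => ‖secondDiff f (s (i + 1) • w) x‖ₑ ^ 2), hsv,
        ← lintegral_const_mul' _ _ (by finiteness)]
      have h4 : ∀ x, ‖2 ^ i * secondDiff f (((2 : ℝ) ^ i)⁻¹ • v) x‖ₑ ^ 2 =
          4 ^ i * ‖secondDiff f (s i • v) x‖ₑ ^ 2 := by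
        intro x
        rw [enorm_mul, mul_pow, enorm_pow, ← pow_mul, mul_comm i 2, pow_mul]
        congr 2
        rw [Real.enorm_eq_ofReal (by norm_num)]
        norm_num
      simp only [a, h4]
      refine lintegral_mono_set (ball_subset_ball' ?_)
      have hs1 : s i ≤ 1 := inv_le_one_of_one_le₀ (one_le_pow₀ (by norm_num))
      have h5 : dist c (c + s i • v) = s i * ‖v‖ := by
        simp [norm_smul, abs_of_pos (hspos i)]
      have h6 : s i * ‖v‖ ≤ 1 * ‖v‖ := by gcongr
      have h7 : 0 ≤ ‖w‖ * (1 - s i) := mul_nonneg (norm_nonneg _) (by linarith)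
      simp only [r]
      rw [h5]
      linarith
    calc F i + a i ≤ 4 ^ i * ((∫⁻ x in ball c (r i), ‖f (x + s i • w) - f x‖ₑ ^ 2) +
          ∫⁻ x in ball c (r i), ‖secondDiff f (s (i + 1) • w) (x + s (i + 1) • w)‖ₑ ^ 2) := by
          rw [mul_add]; gcongr
      _ ≤ 4 ^ i * (4 * ∫⁻ x in ball c (r (i + 1)), ‖f (x + s (i + 1) • w) - f x‖ₑ ^ 2) := by
          gcongr
      _ = F (i + 1) := by simp only [F]; rw [pow_succ, mul_assoc]
  have hbound : ∀ i, F i ≤ (L * ‖w‖ₑ) ^ 2 * volume (ball c (R + 3 * ‖v‖)) := by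
    intro i
    have h1 : ∀ x, ‖f (x + s i • w) - f x‖ₑ ^ 2 ≤ (L * (‖s i‖ₑ * ‖w‖ₑ)) ^ 2 := by
      intro x
      have := hf.edist_le_mul (x + s i • w) x
      rw [edist_eq_enorm_sub, edist_eq_enorm_sub, add_sub_cancel_left, enorm_smul] at this
      gcongr
    have h2 : (4 : ℝ≥0∞) ^ i * (L * (‖s i‖ₑ * ‖w‖ₑ)) ^ 2 = (L * ‖w‖ₑ) ^ 2 := by
      have h3 : (4 : ℝ≥0∞) ^ i * ‖s i‖ₑ ^ 2 = 1 := by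
        have h4 : (4 : ℝ≥0∞) ^ i = ENNReal.ofReal (4 ^ i) := by
          rw [ENNReal.ofReal_pow (by norm_num)]; norm_num
        rw [enorm_sq_eq_ofReal, h4, ← ENNReal.ofReal_mul (by positivity)]
        have h5 : (4 : ℝ) ^ i = (2 ^ i) ^ 2 := by rw [← pow_mul, mul_comm, pow_mul]; norm_num
        simp only [s]
        rw [h5, inv_pow, mul_inv_cancel₀ (by positivity), ENNReal.ofReal_one]
      calc (4 : ℝ≥0∞) ^ i * (L * (‖s i‖ₑ * ‖w‖ₑ)) ^ 2
          = (4 ^ i * ‖s i‖ₑ ^ 2) * (L * ‖w‖ₑ) ^ 2 := by ring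
        _ = _ := by rw [h3, one_mul]
    calc F i ≤ 4 ^ i * ∫⁻ _ in ball c (r i), (L * (‖s i‖ₑ * ‖w‖ₑ)) ^ 2 := by
          simp only [F]; gcongr 4 ^ i * ?_; exact lintegral_mono h1
      _ = (L * ‖w‖ₑ) ^ 2 * volume (ball c (r i)) := by
          rw [setLIntegral_const, ← mul_assoc, h2]
      _ ≤ _ := by
          gcongr
          have : 0 ≤ ‖w‖ * s i := mul_nonneg (norm_nonneg _) (hspos i).le
          simp only [r]
          linarith
  have hsum : ∀ N, F 0 + ∑ i ∈ Finset.range N, a i ≤ F N := by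
    intro N
    induction N with
    | zero => simp
    | succ N ih =>
      rw [Finset.sum_range_succ, ← add_assoc]
      exact (add_le_add_left ih _).trans (hstep N)
  refine ENNReal.tsum_le_of_sum_range_le fun N => ?_
  exact (le_add_self.trans (hsum N)).trans (hbound N)

/-- The squared second differences of `f` at `x`, integrated over all steps of length `< r`. -/
def secondDiffEnergy (f : E → ℝ) (r : ℝ) (x : E) : ℝ≥0∞ :=
  ∫⁻ v in ball (0 : E) r, ‖secondDiff f v x‖ₑ ^ 2

theorem measurable_secondDiffEnergy {f : E → ℝ} (hf : Continuous f) (r : ℝ) :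
    Measurable (secondDiffEnergy f r) := by
  have : Measurable fun q : E × E => ‖secondDiff f q.1 q.2‖ₑ ^ 2 :=
    ((continuous_secondDiff hf).measurable.enorm).pow_const 2
  exact this.lintegral_prod_left'

/-- Carleson-type estimate for the second differences of a Lipschitz function over all dyadic
scales `s 2⁻ⁱ`: the one-directional estimate integrated over the directions. -/
theorem tsum_lintegral_secondDiffEnergy_le {L : ℝ≥0} {f : E → ℝ} (hf : LipschitzWith L f)
    (c : E) {R K s : ℝ} (hK : 0 < K) (hs : 0 < s) :
    ∑' i : ℕ, ∫⁻ x in ball c R, ENNReal.ofReal (((s / 2 ^ i) ^ (finrank ℝ E + 2))⁻¹) *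
        secondDiffEnergy f (K * (s / 2 ^ i)) x ≤
      ENNReal.ofReal (4 * K ^ 2) * volume (ball (0 : E) K) * L ^ 2 *
        volume (ball c (R + 3 * (K * s))) := by
  have hfc := hf.continuous
  have hG : ∀ i : ℕ, Measurable fun q : E × E =>
      ‖2 ^ i * secondDiff f (((2 : ℝ) ^ i)⁻¹ • s • q.1) q.2‖ₑ ^ 2 := by
    intro i
    have h1 : Continuous fun q : E × E => secondDiff f (((2 : ℝ) ^ i)⁻¹ • s • q.1) q.2 :=
      (continuous_secondDiff hfc).comp (by fun_prop :
        Continuous fun q : E × E => (((2 : ℝ) ^ i)⁻¹ • s • q.1, q.2))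
    have h2 := h1.measurable
    fun_prop
  have hpt : ∀ (i : ℕ) (x : E), ENNReal.ofReal (((s / 2 ^ i) ^ (finrank ℝ E + 2))⁻¹) *
      secondDiffEnergy f (K * (s / 2 ^ i)) x = ENNReal.ofReal ((s ^ 2)⁻¹) *
        ∫⁻ v in ball (0 : E) K, ‖2 ^ i * secondDiff f (((2 : ℝ) ^ i)⁻¹ • s • v) x‖ₑ ^ 2 := by
    intro i x
    rw [secondDiffEnergy, setLIntegral_ball_zero_smul _ (by positivity), ← mul_assoc,
      ← ENNReal.ofReal_mul (by positivity)]
    have h1 : ∀ v : E, ‖2 ^ i * secondDiff f (((2 : ℝ) ^ i)⁻¹ • s • v) x‖ₑ ^ 2 =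
        ENNReal.ofReal ((2 ^ i) ^ 2) * ‖secondDiff f ((s / 2 ^ i) • v) x‖ₑ ^ 2 := by
      intro v
      rw [enorm_mul, mul_pow, enorm_sq_eq_ofReal (2 ^ i), smul_smul, div_eq_inv_mul]
    simp_rw [h1]
    rw [lintegral_const_mul' _ _ (by finiteness), ← mul_assoc, ← ENNReal.ofReal_mul (by positivity)]
    congr 2
    rw [pow_add]
    field_simp
  simp_rw [hpt]
  have hswap : ∀ i : ℕ, ∫⁻ x in ball c R, ENNReal.ofReal ((s ^ 2)⁻¹) *
      ∫⁻ v in ball (0 : E) K, ‖2 ^ i * secondDiff f (((2 : ℝ) ^ i)⁻¹ • s • v) x‖ₑ ^ 2 =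
      ENNReal.ofReal ((s ^ 2)⁻¹) * ∫⁻ v in ball (0 : E) K, ∫⁻ x in ball c R,
        ‖2 ^ i * secondDiff f (((2 : ℝ) ^ i)⁻¹ • s • v) x‖ₑ ^ 2 := by
    intro i
    rw [lintegral_const_mul' _ _ (by finiteness), lintegral_lintegral_swap]
    exact ((hG i).comp measurable_swap).aemeasurable
  simp_rw [hswap]
  rw [ENNReal.tsum_mul_left, ← lintegral_tsum
    fun i => ((hG i).lintegral_prod_right').aemeasurable]
  calc ENNReal.ofReal ((s ^ 2)⁻¹) * ∫⁻ v in ball (0 : E) K, ∑' i : ℕ, ∫⁻ x in ball c R,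
        ‖2 ^ i * secondDiff f (((2 : ℝ) ^ i)⁻¹ • s • v) x‖ₑ ^ 2
      ≤ ENNReal.ofReal ((s ^ 2)⁻¹) * ∫⁻ _ in ball (0 : E) K,
          ENNReal.ofReal (4 * K ^ 2 * s ^ 2) * L ^ 2 * volume (ball c (R + 3 * (K * s))) := by
        gcongr ENNReal.ofReal ((s ^ 2)⁻¹) * ?_
        refine setLIntegral_mono measurable_const fun v hv => ?_
        have hv' : ‖s • v‖ ≤ K * s := by
          rw [norm_smul, Real.norm_of_nonneg hs.le, mul_comm]
          have := (mem_ball_zero_iff.1 hv).le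
          gcongr
        refine (tsum_lintegral_secondDiff_sq_le hf c (s • v) R).trans ?_
        gcongr
        rw [mul_pow, mul_comm]
        gcongr
        rw [enorm_smul, mul_pow, ← ofReal_norm (s • v), enorm_sq_eq_ofReal,
          ← ENNReal.ofReal_pow (norm_nonneg _), ← ENNReal.ofReal_mul (by positivity)]
        refine ENNReal.ofReal_le_ofReal ?_
        have : ‖s • v‖ ^ 2 ≤ (K * s) ^ 2 := by gcongr
        nlinarith
    _ = _ := by
        rw [setLIntegral_const]
        have : ENNReal.ofReal ((s ^ 2)⁻¹) * ENNReal.ofReal (4 * K ^ 2 * s ^ 2) =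
            ENNReal.ofReal (4 * K ^ 2) := by
          rw [← ENNReal.ofReal_mul (by positivity)]
          congr 1
          field_simp
        rw [← this]
        ring

end

/-! ### Averages over balls -/

noncomputable section

open Metric Module ProbabilityTheory

set_option linter.unusedSectionVars false

section Smoothing

variable {E : Type*} [NormedAddCommGroup E] [MeasurableSpace E] [BorelSpace E]
  [SecondCountableTopology E]

/-- The average of the translates of `f` with respect to `ρ`. -/
def smoothing (ρ : Measure E) (f : E → ℝ) (x : E) : ℝ := ∫ v, f (x + v) ∂ρ

variable {ρ σ : Measure E} [IsProbabilityMeasure ρ] [IsProbabilityMeasure σ] {L : ℝ≥0} {f g : E → ℝ}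
  {t : ℝ}

theorem norm_le_add_of_lipschitzWith (hf : LipschitzWith L f) (x v : E) :
    ‖f (x + v)‖ ≤ ‖f x‖ + L * ‖v‖ := by
  have := hf.norm_sub_le (x + v) x
  rw [add_sub_cancel_left] at this
  calc ‖f (x + v)‖ = ‖f x + (f (x + v) - f x)‖ := by congr 1; ring
    _ ≤ ‖f x‖ + ‖f (x + v) - f x‖ := norm_add_le _ _
    _ ≤ _ := by gcongr

theorem integrable_comp_add_left_of_lipschitzWith (hf : LipschitzWith L f)
    (hρ : ∀ᵐ v ∂ρ, ‖v‖ ≤ t) (x : E) : Integrable (fun v => f (x + v)) ρ := by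
  refine Integrable.of_bound (C := ‖f x‖ + L * t)
    (hf.continuous.comp (by fun_prop)).aestronglyMeasurable ?_
  filter_upwards [hρ] with v hv
  refine (norm_le_add_of_lipschitzWith hf x v).trans ?_
  gcongr

theorem smoothing_sub (hf : LipschitzWith L f) {L' : ℝ≥0} (hg : LipschitzWith L' g)
    (hρ : ∀ᵐ v ∂ρ, ‖v‖ ≤ t) (x : E) :
    smoothing ρ (fun y => f y - g y) x = smoothing ρ f x - smoothing ρ g x :=
  integral_sub (integrable_comp_add_left_of_lipschitzWith hf hρ x)
    (integrable_comp_add_left_of_lipschitzWith hg hρ x)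

theorem LipschitzWith.smoothing (hf : LipschitzWith L f) (hρ : ∀ᵐ v ∂ρ, ‖v‖ ≤ t) :
    LipschitzWith L (smoothing ρ f) := by
  refine LipschitzWith.of_dist_le_mul fun x y => ?_
  rw [dist_eq_norm, _root_.smoothing, _root_.smoothing,
    ← integral_sub (integrable_comp_add_left_of_lipschitzWith hf hρ x)
    (integrable_comp_add_left_of_lipschitzWith hf hρ y)]
  refine (norm_integral_le_of_norm_le_const (C := L * dist x y) (ae_of_all _ fun v => ?_)).trans ?_
  · simpa [dist_eq_norm] using hf.norm_sub_le (x + v) (y + v)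
  · simp

theorem norm_smoothing_sub_le (hf : LipschitzWith L f) (hρ : ∀ᵐ v ∂ρ, ‖v‖ ≤ t) (x : E) :
    ‖smoothing ρ f x - f x‖ ≤ L * t := by
  have h1 : smoothing ρ f x - f x = ∫ v, (f (x + v) - f x) ∂ρ := by
    rw [integral_sub (integrable_comp_add_left_of_lipschitzWith hf hρ x) (integrable_const _)]
    simp [smoothing]
  rw [h1]
  refine (norm_integral_le_of_norm_le_const (C := L * t) ?_).trans (by simp)
  filter_upwards [hρ] with v hv
  have := hf.norm_sub_le (x + v) x
  rw [add_sub_cancel_left] at this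
  refine this.trans ?_
  gcongr

theorem smoothing_comm (hf : LipschitzWith L f) {s : ℝ} (hρ : ∀ᵐ v ∂ρ, ‖v‖ ≤ t)
    (hσ : ∀ᵐ v ∂σ, ‖v‖ ≤ s) (x : E) :
    smoothing ρ (smoothing σ f) x = smoothing σ (smoothing ρ f) x := by
  unfold smoothing
  rw [integral_integral_swap]
  · simp_rw [add_right_comm]
  · refine Integrable.of_bound (C := ‖f x‖ + L * (t + s))
      (hf.continuous.comp (by fun_prop : Continuous fun q : E × E => x + q.1 + q.2)
        ).aestronglyMeasurable ?_
    have h1 : ∀ᵐ q ∂ρ.prod σ, ‖q.1‖ ≤ t := Measure.quasiMeasurePreserving_fst.ae hρ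
    have h2 : ∀ᵐ q ∂ρ.prod σ, ‖q.2‖ ≤ s := Measure.quasiMeasurePreserving_snd.ae hσ
    filter_upwards [h1, h2] with q hq1 hq2
    change ‖f (x + q.1 + q.2)‖ ≤ _
    rw [add_assoc]
    refine (norm_le_add_of_lipschitzWith hf x _).trans ?_
    gcongr
    exact (norm_add_le _ _).trans (add_le_add hq1 hq2)

/-- Jensen's inequality for the square. -/
theorem enorm_integral_sq_le (hg : AEStronglyMeasurable g ρ) :
    ‖∫ v, g v ∂ρ‖ₑ ^ 2 ≤ ∫⁻ v, ‖g v‖ₑ ^ 2 ∂ρ := by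
  have h1 := ENNReal.lintegral_mul_le_Lp_mul_Lq ρ Real.HolderConjugate.two_two hg.enorm
    (aemeasurable_const (b := (1 : ℝ≥0∞)))
  simp only [Pi.mul_apply, mul_one, ENNReal.one_rpow, lintegral_const, measure_univ] at h1
  calc ‖∫ v, g v ∂ρ‖ₑ ^ 2 ≤ ((∫⁻ v, ‖g v‖ₑ ^ (2 : ℝ) ∂ρ) ^ (1 / 2 : ℝ)) ^ 2 := by
        gcongr
        exact (enorm_integral_le_lintegral_enorm _).trans h1
    _ = _ := by
        rw [← ENNReal.rpow_natCast, ← ENNReal.rpow_mul]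
        norm_num

/-- The comparison of a symmetric average with the function is an average of second differences. -/
theorem smoothing_add_smoothing_sub [ρ.IsNegInvariant] (hf : LipschitzWith L f)
    (hρ : ∀ᵐ v ∂ρ, ‖v‖ ≤ t) (h x : E) :
    smoothing ρ f (x + h) + smoothing ρ f (x - h) - 2 * f x =
      ∫ v, secondDiff f (h + v) x ∂ρ := by
  have h1 : smoothing ρ f (x - h) = ∫ v, f (x - h + -v) ∂ρ :=
    (integral_neg_eq_self (fun v => f (x - h + v)) ρ).symm
  have hi := integrable_comp_add_left_of_lipschitzWith hf hρ (x + h)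
  have hi' : Integrable (fun v => f (x - h + -v)) ρ :=
    (integrable_comp_add_left_of_lipschitzWith hf hρ (x - h)).comp_neg
  have hii : Integrable (fun v => f (x + h + v) + f (x - h + -v)) ρ := hi.add hi'
  have h2 : ∀ v, secondDiff f (h + v) x = f (x + h + v) + f (x - h + -v) - 2 * f x := by
    intro v
    rw [secondDiff]
    congr 3 <;> abel_nf
  simp_rw [h2]
  rw [integral_sub hii (integrable_const _), integral_add hi hi', h1]
  simp [smoothing]

theorem secondDiff_smoothing (hf : LipschitzWith L f) (hρ : ∀ᵐ v ∂ρ, ‖v‖ ≤ t) (h x : E) :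
    secondDiff (smoothing ρ f) h x = smoothing ρ (secondDiff f h) x := by
  have h1 := integrable_comp_add_left_of_lipschitzWith hf hρ (x + h)
  have h2 := integrable_comp_add_left_of_lipschitzWith hf hρ (x - h)
  have h3 := integrable_comp_add_left_of_lipschitzWith hf hρ x
  have h4 : ∀ v, secondDiff f h (x + v) = f (x + h + v) + f (x - h + v) - 2 * f (x + v) := by
    intro v
    rw [secondDiff, add_right_comm x v h, add_sub_right_comm x v h]
  have h12 : Integrable (fun v => f (x + h + v) + f (x - h + v)) ρ := h1.add h2
  rw [smoothing]
  simp_rw [h4]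
  rw [integral_sub h12 (h3.const_mul 2), integral_add h1 h2, integral_const_mul]
  rfl

end Smoothing

variable {E : Type*} [NormedAddCommGroup E] [NormedSpace ℝ E] [FiniteDimensional ℝ E]
  [MeasureSpace E] [BorelSpace E] [(volume : Measure E).IsAddHaarMeasure]

/-- The uniform probability measure on the ball of radius `t` centred at the origin. -/
def uniformBall (E : Type*) [NormedAddCommGroup E] [MeasureSpace E] (t : ℝ) : Measure E :=
  volume[|ball (0 : E) t]

theorem isProbabilityMeasure_uniformBall {t : ℝ} (ht : 0 < t) :
    IsProbabilityMeasure (uniformBall E t) :=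
  cond_isProbabilityMeasure_of_finite (measure_ball_pos _ _ ht).ne' measure_ball_lt_top.ne

theorem lintegral_uniformBall (t : ℝ) (g : E → ℝ≥0∞) :
    ∫⁻ v, g v ∂uniformBall E t = (volume (ball (0 : E) t))⁻¹ * ∫⁻ v in ball (0 : E) t, g v := by
  rw [uniformBall, ProbabilityTheory.cond, lintegral_smul_measure, smul_eq_mul]

theorem ae_uniformBall_norm_le (t : ℝ) : ∀ᵐ v ∂uniformBall E t, ‖v‖ ≤ t := by
  have : ∀ᵐ v ∂uniformBall E t, v ∈ ball (0 : E) t :=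
    ae_cond_mem measurableSet_ball
  filter_upwards [this] with v hv
  exact (mem_ball_zero_iff.1 hv).le

instance isNegInvariant_uniformBall (t : ℝ) : (uniformBall E t).IsNegInvariant := by
  constructor
  rw [Measure.neg, uniformBall, ProbabilityTheory.cond, Measure.map_smul]
  congr 1
  have h1 := (MeasurableEquiv.neg E).measurableEmbedding.restrict_map volume (ball (0 : E) t)
  have h2 : (⇑(MeasurableEquiv.neg E) ⁻¹' ball (0 : E) t) = ball 0 t := by
    ext x; simp
  have h3 : Measure.map (⇑(MeasurableEquiv.neg E)) (volume : Measure E) = volume :=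
    Measure.map_neg_eq_self volume
  rw [h2, h3] at h1
  exact h1.symm

/-- The average of `f` over balls of radius `t`. -/
def ballSmoothing (t : ℝ) (f : E → ℝ) : E → ℝ := smoothing (uniformBall E t) f

variable {L : ℝ≥0} {f : E → ℝ} {t r : ℝ}

theorem LipschitzWith.ballSmoothing (hf : LipschitzWith L f) (ht : 0 < t) :
    LipschitzWith L (ballSmoothing t f) :=
  have := isProbabilityMeasure_uniformBall (E := E) ht
  hf.smoothing (ae_uniformBall_norm_le t)

theorem enorm_ballSmoothing_sq_le (hf : Continuous f) (ht : 0 < t) (x : E) :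
    ‖ballSmoothing t f x‖ₑ ^ 2 ≤
      (volume (ball (0 : E) t))⁻¹ * ∫⁻ z in ball x t, ‖f z‖ₑ ^ 2 := by
  have := isProbabilityMeasure_uniformBall (E := E) ht
  have hc : Continuous fun v => f (x + v) := hf.comp (by fun_prop)
  refine (enorm_integral_sq_le hc.aestronglyMeasurable).trans ?_
  rw [lintegral_uniformBall, setLIntegral_ball_comp_add_left (fun z => ‖f z‖ₑ ^ 2), add_zero]

theorem enorm_ballSmoothing_add_sub_sq_le (hf : LipschitzWith L f) (ht : 0 < t) {h : E}
    (hr : ‖h‖ + t ≤ r) (x : E) :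
    ‖ballSmoothing t f (x + h) + ballSmoothing t f (x - h) - 2 * f x‖ₑ ^ 2 ≤
      (volume (ball (0 : E) t))⁻¹ * secondDiffEnergy f r x := by
  have := isProbabilityMeasure_uniformBall (E := E) ht
  rw [ballSmoothing, smoothing_add_smoothing_sub hf (ae_uniformBall_norm_le t)]
  refine (enorm_integral_sq_le ?_).trans ?_
  · exact ((continuous_secondDiff hf.continuous).comp
      (by fun_prop : Continuous fun v : E => (h + v, x))).aestronglyMeasurable
  · rw [lintegral_uniformBall,
      setLIntegral_ball_comp_add_left (fun v => ‖secondDiff f v x‖ₑ ^ 2), add_zero]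
    gcongr
    refine lintegral_mono_set (ball_subset_ball' ?_)
    rw [dist_zero_right]
    linarith

theorem enorm_add_sq_le (a b : ℝ) : ‖a + b‖ₑ ^ 2 ≤ 2 * (‖a‖ₑ ^ 2 + ‖b‖ₑ ^ 2) := by
  have h2 : (2 : ℝ≥0∞) = ENNReal.ofReal 2 := by simp
  simp only [enorm_sq_eq_ofReal]
  rw [h2, ← ENNReal.ofReal_add (by positivity) (by positivity),
    ← ENNReal.ofReal_mul (by norm_num)]
  exact ENNReal.ofReal_le_ofReal (by nlinarith [sq_nonneg (a - b)])

theorem enorm_sub_sq_le (a b : ℝ) : ‖a - b‖ₑ ^ 2 ≤ 2 * (‖a‖ₑ ^ 2 + ‖b‖ₑ ^ 2) := by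
  simpa [sub_eq_add_neg] using enorm_add_sq_le a (-b)

theorem enorm_ballSmoothing_sub_sq_le (hf : LipschitzWith L f) (ht : 0 < t) (hr : t ≤ r) (x : E) :
    ‖ballSmoothing t f x - f x‖ₑ ^ 2 ≤
      (volume (ball (0 : E) t))⁻¹ * secondDiffEnergy f r x := by
  refine le_trans ?_ (enorm_ballSmoothing_add_sub_sq_le hf ht (h := 0) (by simpa using hr) x)
  rw [add_zero, sub_zero, enorm_sq_eq_ofReal, enorm_sq_eq_ofReal]
  exact ENNReal.ofReal_le_ofReal (by nlinarith [sq_nonneg (ballSmoothing t f x - f x)])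

theorem enorm_secondDiff_ballSmoothing_sq_le (hf : LipschitzWith L f) (ht : 0 < t) {h : E}
    (hr : ‖h‖ + t ≤ r) (x : E) :
    ‖secondDiff (ballSmoothing t f) h x‖ₑ ^ 2 ≤
      4 * (volume (ball (0 : E) t))⁻¹ * secondDiffEnergy f r x := by
  have h1 := enorm_ballSmoothing_add_sub_sq_le hf ht hr x
  have h2 := enorm_ballSmoothing_add_sub_sq_le hf ht (h := 0) (r := r)
    (by rw [norm_zero]; linarith [norm_nonneg h]) x
  have h3 : secondDiff (ballSmoothing t f) h x =
      (ballSmoothing t f (x + h) + ballSmoothing t f (x - h) - 2 * f x) -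
      (ballSmoothing t f (x + 0) + ballSmoothing t f (x - 0) - 2 * f x) := by
    rw [secondDiff, add_zero, sub_zero]; ring
  rw [h3]
  refine (enorm_sub_sq_le _ _).trans ((mul_le_mul_right (add_le_add h1 h2) 2).trans_eq ?_)
  ring

/-- The twice averaged function has small second differences at every point: the second average
turns a bound in the mean into a pointwise one. -/
theorem enorm_secondDiff_ballSmoothing_ballSmoothing_sq_le (hf : LipschitzWith L f) (ht : 0 < t)
    {h : E} (hr : ‖h‖ + t ≤ r) (x : E) :
    ‖secondDiff (ballSmoothing t (ballSmoothing t f)) h x‖ₑ ^ 2 ≤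
      4 * ((volume (ball (0 : E) t))⁻¹ ^ 2 * ∫⁻ z in ball x t, secondDiffEnergy f r z) := by
  have := isProbabilityMeasure_uniformBall (E := E) ht
  have hc : Continuous (secondDiff (ballSmoothing t f) h) :=
    (continuous_secondDiff (hf.ballSmoothing ht).continuous).comp
      (by fun_prop : Continuous fun x : E => (h, x))
  have h1 : secondDiff (ballSmoothing t (ballSmoothing t f)) h x =
      ballSmoothing t (secondDiff (ballSmoothing t f) h) x :=
    secondDiff_smoothing (hf.ballSmoothing ht) (ae_uniformBall_norm_le t) h x
  rw [h1]
  refine (enorm_ballSmoothing_sq_le hc ht x).trans ?_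
  calc (volume (ball (0 : E) t))⁻¹ * ∫⁻ z in ball x t, ‖secondDiff (ballSmoothing t f) h z‖ₑ ^ 2
      ≤ (volume (ball (0 : E) t))⁻¹ * ∫⁻ z in ball x t,
        4 * (volume (ball (0 : E) t))⁻¹ * secondDiffEnergy f r z := by
        gcongr with z
        exact enorm_secondDiff_ballSmoothing_sq_le hf ht hr z
    _ = _ := by
        rw [lintegral_const_mul _ (measurable_secondDiffEnergy hf.continuous r)]
        ring

theorem inv_volume_ball_half (t : ℝ) :
    (volume (ball (0 : E) (t / 2)))⁻¹ = 2 ^ finrank ℝ E * (volume (ball (0 : E) t))⁻¹ := by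
  have h := Measure.addHaar_ball_mul_of_pos (volume : Measure E) 0 (r := 2⁻¹) (by norm_num) t
  have h2 : (2 : ℝ)⁻¹ * t = t / 2 := by ring
  have h3 : ENNReal.ofReal ((2 : ℝ)⁻¹ ^ finrank ℝ E) = (2 ^ finrank ℝ E)⁻¹ := by
    rw [inv_pow, ENNReal.ofReal_inv_of_pos (by positivity), ENNReal.ofReal_pow (by norm_num)]
    norm_num
  rw [← h2, h, h3, ENNReal.mul_inv (Or.inl (by simp)) (Or.inl (by simp)), inv_inv]

/-- The twice averaged functions at two consecutive dyadic scales differ, at every point, by a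
local mean of second differences. With `M` the average over balls, this follows from
`M_t² - M_{t/2}² = (M_t + M_{t/2}) ((M_t - 1) - (M_{t/2} - 1))`. -/
theorem enorm_ballSmoothing_ballSmoothing_sub_sq_le (hf : LipschitzWith L f) (ht : 0 < t)
    (hr : t ≤ r) (x : E) :
    ‖ballSmoothing (t / 2) (ballSmoothing (t / 2) f) x - ballSmoothing t (ballSmoothing t f) x‖ₑ ^ 2
      ≤ 4 * (1 + 2 ^ finrank ℝ E) ^ 2 *
        ((volume (ball (0 : E) t))⁻¹ ^ 2 * ∫⁻ z in ball x t, secondDiffEnergy f r z) := by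
  have hs : 0 < t / 2 := half_pos ht
  have := isProbabilityMeasure_uniformBall (E := E) ht
  have := isProbabilityMeasure_uniformBall (E := E) hs
  have hft := hf.ballSmoothing ht
  have hfs := hf.ballSmoothing hs
  set b := (volume (ball (0 : E) t))⁻¹ with hb
  set g : E → ℝ := fun y => ballSmoothing (t / 2) f y - ballSmoothing t f y with hg
  have hgc : Continuous g := hfs.continuous.sub hft.continuous
  have hgb : ∀ y, ‖g y‖ₑ ^ 2 ≤ 2 * (1 + 2 ^ finrank ℝ E) * b * secondDiffEnergy f r y := by
    intro y
    have h1 := enorm_ballSmoothing_sub_sq_le hf ht hr y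
    have h2 := enorm_ballSmoothing_sub_sq_le hf hs (r := r) (by linarith) y
    rw [inv_volume_ball_half t] at h2
    have h3 : g y = (ballSmoothing (t / 2) f y - f y) - (ballSmoothing t f y - f y) := by
      rw [hg]; ring
    rw [h3]
    refine (enorm_sub_sq_le _ _).trans ((mul_le_mul_right (add_le_add h2 h1) 2).trans_eq ?_)
    ring
  have hI : ∫⁻ z in ball x t, ‖g z‖ₑ ^ 2 ≤
      2 * (1 + 2 ^ finrank ℝ E) * b * ∫⁻ z in ball x t, secondDiffEnergy f r z := by
    rw [← lintegral_const_mul _ (measurable_secondDiffEnergy hf.continuous r)]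
    exact lintegral_mono hgb
  have hdec : ballSmoothing (t / 2) (ballSmoothing (t / 2) f) x -
      ballSmoothing t (ballSmoothing t f) x = ballSmoothing (t / 2) g x + ballSmoothing t g x := by
    have h1 : ballSmoothing (t / 2) g x = ballSmoothing (t / 2) (ballSmoothing (t / 2) f) x -
        ballSmoothing (t / 2) (ballSmoothing t f) x :=
      smoothing_sub hfs hft (ae_uniformBall_norm_le _) x
    have h2 : ballSmoothing t g x = ballSmoothing t (ballSmoothing (t / 2) f) x -
        ballSmoothing t (ballSmoothing t f) x :=
      smoothing_sub hfs hft (ae_uniformBall_norm_le _) x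
    have h3 : ballSmoothing t (ballSmoothing (t / 2) f) x =
        ballSmoothing (t / 2) (ballSmoothing t f) x :=
      smoothing_comm hf (ae_uniformBall_norm_le _) (ae_uniformBall_norm_le _) x
    rw [h1, h2, h3]
    ring
  have h1 := enorm_ballSmoothing_sq_le hgc ht x
  have h2 : ‖ballSmoothing (t / 2) g x‖ₑ ^ 2 ≤
      2 ^ finrank ℝ E * b * ∫⁻ z in ball x t, ‖g z‖ₑ ^ 2 := by
    refine (enorm_ballSmoothing_sq_le hgc hs x).trans ?_
    rw [inv_volume_ball_half t]
    gcongr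
    linarith
  rw [hdec]
  calc _ ≤ 2 * (2 ^ finrank ℝ E * b * (∫⁻ z in ball x t, ‖g z‖ₑ ^ 2) +
        b * ∫⁻ z in ball x t, ‖g z‖ₑ ^ 2) :=
        (enorm_add_sq_le _ _).trans (mul_le_mul_right (add_le_add h2 h1) 2)
    _ = 2 * (1 + 2 ^ finrank ℝ E) * b * ∫⁻ z in ball x t, ‖g z‖ₑ ^ 2 := by ring
    _ ≤ 2 * (1 + 2 ^ finrank ℝ E) * b *
        (2 * (1 + 2 ^ finrank ℝ E) * b * ∫⁻ z in ball x t, secondDiffEnergy f r z) := by gcongr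
    _ = _ := by ring

theorem tendsto_ballSmoothing_ballSmoothing (hf : LipschitzWith L f) (ht : 0 < t) (x : E) :
    Filter.Tendsto (fun k : ℕ => ballSmoothing (t / 2 ^ k) (ballSmoothing (t / 2 ^ k) f) x)
      Filter.atTop (nhds (f x)) := by
  have h1 : Filter.Tendsto (fun k : ℕ => 2 * (L * (t * (1 / 2) ^ k))) Filter.atTop (nhds 0) := by
    have := (tendsto_pow_atTop_nhds_zero_of_lt_one (r := (1 / 2 : ℝ)) (by norm_num)
      (by norm_num)).const_mul t |>.const_mul (L : ℝ) |>.const_mul 2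
    simpa using this
  rw [tendsto_iff_norm_sub_tendsto_zero]
  refine squeeze_zero (fun _ => norm_nonneg _) (fun k => ?_) h1
  have hk : 0 < t / 2 ^ k := by positivity
  have := isProbabilityMeasure_uniformBall (E := E) hk
  have h2 := norm_smoothing_sub_le (hf.ballSmoothing hk) (ae_uniformBall_norm_le (t / 2 ^ k)) x
  have h3 := norm_smoothing_sub_le hf (ae_uniformBall_norm_le (t / 2 ^ k)) x
  have h4 := norm_add_le (ballSmoothing (t / 2 ^ k) (ballSmoothing (t / 2 ^ k) f) x -
    ballSmoothing (t / 2 ^ k) f x) (ballSmoothing (t / 2 ^ k) f x - f x)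
  rw [sub_add_sub_cancel] at h4
  have h5 : t * (1 / 2) ^ k = t / 2 ^ k := by rw [one_div, inv_pow]; rfl
  rw [h5]
  simp only [ballSmoothing] at *
  linarith

end

/-! ### Small second differences and affine approximation -/

noncomputable section

open Metric

/-- On an interval, a continuous function which vanishes at both ends and has second differences
bounded by `δ` is bounded by `δ`: reflect the nearer endpoint in a point where `|w|` is maximal. -/
theorem abs_le_of_abs_secondDiff_le {w : ℝ → ℝ} (hw : Continuous w) {r δ : ℝ} (hr : 0 ≤ r)
    (h0 : w 0 = 0) (hwr : w r = 0)
    (hδ : ∀ x h : ℝ, x + h ∈ Set.Icc 0 r → x - h ∈ Set.Icc 0 r → |secondDiff w h x| ≤ δ) :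
    ∀ s ∈ Set.Icc 0 r, |w s| ≤ δ := by
  obtain ⟨m, hm, hmax⟩ := isCompact_Icc.exists_isMaxOn (Set.nonempty_Icc.2 hr)
    (hw.abs.continuousOn (s := Set.Icc 0 r))
  have hmax' : ∀ s ∈ Set.Icc 0 r, |w s| ≤ |w m| := fun s hs => hmax hs
  have key : ∀ h : ℝ, m + h ∈ Set.Icc 0 r → m - h ∈ Set.Icc 0 r →
      (w (m + h) = 0 ∨ w (m - h) = 0) → |w m| ≤ δ := by
    intro h h1 h2 h3
    have h4 := hδ m h h1 h2
    rw [secondDiff] at h4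
    have h5 : |w (m + h) + w (m - h)| ≤ |w m| := by
      rcases h3 with h3 | h3
      · rw [h3, zero_add]; exact hmax' _ h2
      · rw [h3, add_zero]; exact hmax' _ h1
    have h6 := abs_sub_abs_le_abs_sub (2 * w m) (w (m + h) + w (m - h))
    rw [abs_sub_comm, abs_mul, abs_two] at h6
    linarith
  intro s hs
  refine (hmax' s hs).trans ?_
  rcases le_total (2 * m) r with h | h
  · refine key m ⟨by linarith [hm.1], by linarith⟩ (by simpa using hr) (Or.inr (by simpa using h0))
  · refine key (r - m) (by simpa using hr) ⟨by linarith, by linarith [hm.2]⟩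
      (Or.inl (by simpa using hwr))

variable {n : ℕ} {g : EuclideanSpace ℝ (Fin n) → ℝ} {c : EuclideanSpace ℝ (Fin n)} {r δ : ℝ}

/-- Bounded second differences make `h ↦ g (c + h) - g c` almost additive. -/
theorem abs_sub_sub_add_le_of_abs_secondDiff_le
    (hδ : ∀ x h, x + h ∈ closedBall c r → x - h ∈ closedBall c r → |secondDiff g h x| ≤ δ)
    {a b : EuclideanSpace ℝ (Fin n)} (ha : ‖a‖ ≤ r) (hb : ‖b‖ ≤ r) (hab : ‖a + b‖ ≤ r) :
    |g (c + (a + b)) - g (c + a) - g (c + b) + g c| ≤ 2 * δ := by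
  have hr : 0 ≤ r := (norm_nonneg a).trans ha
  have e1 : c + (2⁻¹ : ℝ) • (a + b) + (2⁻¹ : ℝ) • (a - b) = c + a := by module
  have e2 : c + (2⁻¹ : ℝ) • (a + b) - (2⁻¹ : ℝ) • (a - b) = c + b := by module
  have e3 : c + (2⁻¹ : ℝ) • (a + b) + (2⁻¹ : ℝ) • (a + b) = c + (a + b) := by module
  have e4 : c + (2⁻¹ : ℝ) • (a + b) - (2⁻¹ : ℝ) • (a + b) = c := by module
  have h1 := hδ (c + (2⁻¹ : ℝ) • (a + b)) ((2⁻¹ : ℝ) • (a - b))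
    (by rw [e1]; simpa using ha) (by rw [e2]; simpa using hb)
  have h2 := hδ (c + (2⁻¹ : ℝ) • (a + b)) ((2⁻¹ : ℝ) • (a + b))
    (by rw [e3]; simpa using hab) (by rw [e4]; simpa using hr)
  rw [secondDiff, e1, e2] at h1
  rw [secondDiff, e3, e4] at h2
  rw [abs_le] at *
  constructor <;> linarith [h1.1, h1.2, h2.1, h2.2]

theorem abs_sub_mul_smul_le_of_abs_secondDiff_le (hg : Continuous g) (hr : 0 < r)
    (hδ : ∀ x h, x + h ∈ closedBall c r → x - h ∈ closedBall c r → |secondDiff g h x| ≤ δ)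
    {e : EuclideanSpace ℝ (Fin n)} (he : ‖e‖ = 1) {s : ℝ} (hs : |s| ≤ r) :
    |g (c + s • e) - g c - s / r * (g (c + r • e) - g c)| ≤ 2 * δ := by
  set m := g (c + r • e) - g c with hm
  have hpos : ∀ s ∈ Set.Icc 0 r, |g (c + s • e) - g c - s / r * m| ≤ δ := by
    refine abs_le_of_abs_secondDiff_le (by fun_prop) hr.le ?_ ?_ ?_
    · simp
    · rw [div_self hr.ne', one_mul, sub_self]
    · intro x h h1 h2
      have h3 := hδ (c + x • e) (h • e)
        (by
          rw [add_assoc, ← add_smul]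
          simpa [norm_smul, he, abs_of_nonneg h1.1] using h1.2)
        (by
          rw [add_sub_assoc, ← sub_smul]
          simpa [norm_smul, he, abs_of_nonneg h2.1] using h2.2)
      rw [secondDiff, add_assoc c, add_sub_assoc c, ← add_smul, ← sub_smul] at h3
      rw [secondDiff]
      convert! h3 using 2
      ring
  rcases le_total 0 s with h | h
  · have h0 := hpos 0 ⟨le_rfl, hr.le⟩
    have := hpos s ⟨h, (le_abs_self s).trans hs⟩
    linarith [abs_nonneg (g (c + (0 : ℝ) • e) - g c - 0 / r * m)]
  · have h1 := hpos (-s) ⟨by linarith, (neg_le_abs s).trans hs⟩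
    have h2 := hδ c (s • e) (by simpa [norm_smul, he] using hs) (by simpa [norm_smul, he] using hs)
    rw [secondDiff, sub_eq_add_neg c, ← neg_smul] at h2
    rw [abs_le] at *
    have h3 : -s / r * m = -(s / r * m) := by ring
    rw [h3] at h1
    constructor <;> linarith [h1.1, h1.2, h2.1, h2.2]

/-- A continuous function with second differences bounded by `δ` on a ball is within `4 n δ` of an
affine function there. -/
theorem exists_affineMap_abs_sub_le (hg : Continuous g) (hr : 0 < r)
    (hδ : ∀ x h, x + h ∈ closedBall c r → x - h ∈ closedBall c r → |secondDiff g h x| ≤ δ) :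
    ∃ A : EuclideanSpace ℝ (Fin n) →ᵃ[ℝ] ℝ, ∀ x ∈ closedBall c r, |g x - A x| ≤ 4 * n * δ := by
  let m : Fin n → ℝ := fun i => g (c + r • EuclideanSpace.single i (1 : ℝ)) - g c
  let l : EuclideanSpace ℝ (Fin n) →ₗ[ℝ] ℝ :=
    ∑ i, (m i / r) • (EuclideanSpace.proj i : EuclideanSpace ℝ (Fin n) →L[ℝ] ℝ).toLinearMap
  have hl : ∀ v, l v = ∑ i, v i / r * m i := by
    intro v
    simp only [l, LinearMap.sum_apply, LinearMap.smul_apply, smul_eq_mul]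
    refine Finset.sum_congr rfl fun i _ => ?_
    simp
    ring
  refine ⟨l.toAffineMap + AffineMap.const ℝ _ (g c - l c), fun x hx => ?_⟩
  obtain ⟨v, rfl⟩ : ∃ v, x = c + v := ⟨x - c, by abel⟩
  have hv : ‖v‖ ≤ r := by simpa using hx
  -- `tr S` keeps the coordinates of `v` in `S`
  let tr : Finset (Fin n) → EuclideanSpace ℝ (Fin n) :=
    fun S => WithLp.toLp 2 fun j => if j ∈ S then v j else 0
  have htr : ∀ S, ‖tr S‖ ≤ r := by
    intro S
    refine le_trans ?_ hv
    rw [EuclideanSpace.norm_eq, EuclideanSpace.norm_eq]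
    refine Real.sqrt_le_sqrt (Finset.sum_le_sum fun j _ => ?_)
    simp only [tr]
    split_ifs
    · rfl
    · simp [sq_nonneg]
  have hcoord : ∀ i, |v i| ≤ r := fun i => (PiLp.norm_apply_le v i).trans hv
  have hind : ∀ S : Finset (Fin n),
      |g (c + tr S) - g c - ∑ i ∈ S, v i / r * m i| ≤ S.card * (4 * δ) := by
    intro S
    induction S using Finset.induction_on with
    | empty =>
      have : tr ∅ = 0 := by ext j; simp [tr]
      simp [this]
    | insert i S hi ih =>
      have h1 : tr (insert i S) = tr S + v i • EuclideanSpace.single i (1 : ℝ) := by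
        ext j
        by_cases hj : j = i
        · subst hj; simp [tr, hi]
        · simp [tr, hj]
      have h2 := abs_sub_sub_add_le_of_abs_secondDiff_le hδ (htr S)
        (by simpa [norm_smul] using hcoord i : ‖v i • EuclideanSpace.single i (1 : ℝ)‖ ≤ r)
        (by rw [← h1]; exact htr _)
      have h3 := abs_sub_mul_smul_le_of_abs_secondDiff_le hg hr hδ
        (by simp : ‖EuclideanSpace.single i (1 : ℝ)‖ = 1) (hcoord i)
      rw [← h1] at h2
      rw [Finset.sum_insert hi, Finset.card_insert_of_notMem hi]
      push_cast
      simp only [m] at *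
      rw [abs_le] at *
      constructor <;> linarith [h2.1, h2.2, h3.1, h3.2, ih.1, ih.2]
  have h := hind Finset.univ
  have huniv : tr Finset.univ = v := by ext j; simp [tr]
  rw [huniv, ← hl, Finset.card_univ, Fintype.card_fin] at h
  have hA : (l.toAffineMap + AffineMap.const ℝ (EuclideanSpace ℝ (Fin n)) (g c - l c)) (c + v) =
      g c + l v := by
    simp
    ring
  rw [hA, ← sub_sub]
  linarith

end

/-! ### Pointwise multiscale bounds and means over balls -/

noncomputable section

open Metric Module

/-- Cauchy-Schwarz with geometric weights, for a telescoping series. -/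
theorem enorm_sub_sq_le_tsum_of_tendsto {a : ℕ → ℝ} {l θ : ℝ}
    (ha : Filter.Tendsto a Filter.atTop (nhds l)) (hθ : 0 < θ) (hθ1 : θ < 1) :
    ‖l - a 0‖ₑ ^ 2 ≤ ENNReal.ofReal ((1 - θ)⁻¹) *
      ∑' k, ENNReal.ofReal ((θ ^ k)⁻¹) * ‖a (k + 1) - a k‖ₑ ^ 2 := by
  have hlim : Filter.Tendsto (fun N => ‖a N - a 0‖ₑ ^ 2) Filter.atTop (nhds (‖l - a 0‖ₑ ^ 2)) := by
    have h1 : Continuous fun y : ℝ => ENNReal.ofReal ((y - a 0) ^ 2) :=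
      ENNReal.continuous_ofReal.comp (by fun_prop)
    simp_rw [enorm_sq_eq_ofReal]
    exact (h1.tendsto l).comp ha
  refine le_of_tendsto' hlim fun N => ?_
  have h1 : a N - a 0 = ∑ k ∈ Finset.range N, (a (k + 1) - a k) :=
    (Finset.sum_range_sub a N).symm
  have h2 : (a N - a 0) ^ 2 ≤ (∑ k ∈ Finset.range N, θ ^ k) *
      ∑ k ∈ Finset.range N, (θ ^ k)⁻¹ * (a (k + 1) - a k) ^ 2 := by
    rw [h1]
    refine Finset.sum_sq_le_sum_mul_sum_of_sq_le_mul _ (fun k _ => by positivity)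
      (fun k _ => by positivity) fun k _ => le_of_eq ?_
    field_simp
  have h3 : ∑ k ∈ Finset.range N, θ ^ k ≤ (1 - θ)⁻¹ := by
    rw [← tsum_geometric_of_lt_one hθ.le hθ1]
    exact (summable_geometric_of_lt_one hθ.le hθ1).sum_le_tsum _ fun k _ => by positivity
  have h4 : (a N - a 0) ^ 2 ≤ (1 - θ)⁻¹ *
      ∑ k ∈ Finset.range N, (θ ^ k)⁻¹ * (a (k + 1) - a k) ^ 2 :=
    h2.trans (mul_le_mul_of_nonneg_right h3 (Finset.sum_nonneg fun k _ => by positivity))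
  have h5 : (0 : ℝ) ≤ (1 - θ)⁻¹ := inv_nonneg.2 (by linarith)
  rw [enorm_sq_eq_ofReal]
  refine (ENNReal.ofReal_le_ofReal h4).trans ?_
  rw [ENNReal.ofReal_mul h5, ENNReal.ofReal_sum_of_nonneg fun k _ => by positivity]
  gcongr
  refine le_trans (le_of_eq ?_) (ENNReal.sum_le_tsum (Finset.range N))
  refine Finset.sum_congr rfl fun k _ => ?_
  rw [ENNReal.ofReal_mul (by positivity), enorm_sq_eq_ofReal]

variable {n : ℕ} {L : ℝ≥0} {f : EuclideanSpace ℝ (Fin n) → ℝ}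

/-- Pointwise multiscale bound. The affine function approximates the twice averaged function at
scale `ℓ`, and the passage from there to `f` is telescoped over the dyadic scales `ℓ 2⁻ᵏ`. -/
theorem exists_affineMap_enorm_sub_sq_le (hf : LipschitzWith L f) (c : EuclideanSpace ℝ (Fin n))
    {D l θ : ℝ} (hD : 0 < D) (hl : 0 < l) (hθ : 0 < θ) (hθ1 : θ < 1) :
    ∃ A : EuclideanSpace ℝ (Fin n) →ᵃ[ℝ] ℝ, ∀ x ∈ ball c (D * l), ‖f x - A x‖ₑ ^ 2 ≤
      2 * (ENNReal.ofReal ((1 - θ)⁻¹) * (4 * (1 + 2 ^ n) ^ 2) + 64 * n ^ 2) *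
        ∑' k : ℕ, ENNReal.ofReal ((θ ^ k)⁻¹) *
          ((volume (ball (0 : EuclideanSpace ℝ (Fin n)) (l / 2 ^ k)))⁻¹ ^ 2 *
            ∫⁻ z in ball x (2 * (D + 1) * (l / 2 ^ k)),
              secondDiffEnergy f ((D + 1) * (l / 2 ^ k)) z) := by
  set T : ℕ → EuclideanSpace ℝ (Fin n) → ℝ :=
    fun k => ballSmoothing (l / 2 ^ k) (ballSmoothing (l / 2 ^ k) f) with hT
  have hlk : ∀ k : ℕ, 0 < l / 2 ^ k := fun k => by positivity
  set B : ℕ → EuclideanSpace ℝ (Fin n) → ℝ≥0∞ := fun k x =>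
    (volume (ball (0 : EuclideanSpace ℝ (Fin n)) (l / 2 ^ k)))⁻¹ ^ 2 *
      ∫⁻ z in ball x (2 * (D + 1) * (l / 2 ^ k)), secondDiffEnergy f ((D + 1) * (l / 2 ^ k)) z
    with hB
  set b := (volume (ball (0 : EuclideanSpace ℝ (Fin n)) l))⁻¹ with hb
  have hstep : ∀ k x, ‖T (k + 1) x - T k x‖ₑ ^ 2 ≤ 4 * (1 + 2 ^ n) ^ 2 * B k x := by
    intro k x
    have h1 := enorm_ballSmoothing_ballSmoothing_sub_sq_le hf (hlk k)
      (r := (D + 1) * (l / 2 ^ k)) (by nlinarith [hlk k]) x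
    rw [finrank_euclideanSpace_fin, div_div, ← pow_succ] at h1
    refine h1.trans ?_
    simp only [hB]
    gcongr
    nlinarith [hlk k]
  have htele : ∀ x, ‖f x - T 0 x‖ₑ ^ 2 ≤ ENNReal.ofReal ((1 - θ)⁻¹) * (4 * (1 + 2 ^ n) ^ 2) *
      ∑' k, ENNReal.ofReal ((θ ^ k)⁻¹) * B k x := by
    intro x
    refine (enorm_sub_sq_le_tsum_of_tendsto (tendsto_ballSmoothing_ballSmoothing hf hl x)
      hθ hθ1).trans ?_
    have h1 : 4 * (1 + 2 ^ n) ^ 2 * ∑' k, ENNReal.ofReal ((θ ^ k)⁻¹) * B k x =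
        ∑' k, 4 * (1 + 2 ^ n) ^ 2 * (ENNReal.ofReal ((θ ^ k)⁻¹) * B k x) :=
      ENNReal.tsum_mul_left.symm
    rw [mul_assoc, h1]
    refine mul_le_mul_right (ENNReal.tsum_le_tsum fun k => ?_) _
    refine (mul_le_mul_right (hstep k x) _).trans_eq ?_
    ring
  set J := ∫⁻ z in ball c ((D + 1) * l), secondDiffEnergy f ((D + 1) * l) z with hJ
  -- the affine error is absorbed by the first term, whose ball around `x` covers `ball c ((D + 1) l)`
  have hJB : ∀ x ∈ ball c (D * l), b ^ 2 * J ≤ ∑' k, ENNReal.ofReal ((θ ^ k)⁻¹) * B k x := by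
    intro x hx
    refine le_trans ?_ (ENNReal.le_tsum 0)
    simp only [hB, pow_zero, inv_one, ENNReal.ofReal_one, one_mul, div_one]
    rw [hJ]
    gcongr
    refine ball_subset_ball' ?_
    have := mem_ball'.1 hx
    nlinarith
  have haff : ∃ A : EuclideanSpace ℝ (Fin n) →ᵃ[ℝ] ℝ, ∀ x ∈ ball c (D * l),
      ‖T 0 x - A x‖ₑ ^ 2 ≤ 64 * n ^ 2 * (b ^ 2 * J) := by
    by_cases hfin : b ^ 2 * J = ∞
    -- nothing to prove if `J` is infinite, except that for `n = 0` the right side is `0`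
    · rcases Nat.eq_zero_or_pos n with hn | hn
      · subst hn
        refine ⟨AffineMap.const ℝ _ (T 0 0), fun x _ => ?_⟩
        rw [Subsingleton.elim x 0]
        simp
      · refine ⟨0, fun x _ => ?_⟩
        rw [hfin, ENNReal.mul_top]
        · exact le_top
        · have : n ≠ 0 := hn.ne'
          simp [this]
    · have hsd : ∀ x h, x + h ∈ closedBall c (D * l) → x - h ∈ closedBall c (D * l) →
          |secondDiff (T 0) h x| ≤ √(4 * (b ^ 2 * J).toReal) := by
        intro x h h1 h2
        rw [mem_closedBall, dist_eq_norm] at h1 h2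
        have hh : ‖h‖ ≤ D * l := by
          have h3 : h = (2⁻¹ : ℝ) • ((x + h - c) - (x - h - c)) := by module
          rw [h3, norm_smul, Real.norm_of_nonneg (by norm_num)]
          linarith [norm_sub_le (x + h - c) (x - h - c)]
        have hx : ‖x - c‖ ≤ D * l := by
          have h3 : x - c = (2⁻¹ : ℝ) • ((x + h - c) + (x - h - c)) := by module
          rw [h3, norm_smul, Real.norm_of_nonneg (by norm_num)]
          linarith [norm_add_le (x + h - c) (x - h - c)]
        refine Real.abs_le_sqrt ?_
        have h4 := enorm_secondDiff_ballSmoothing_ballSmoothing_sq_le hf hl (h := h)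
          (r := (D + 1) * l) (by linarith) x
        have h5 : ‖secondDiff (T 0) h x‖ₑ ^ 2 ≤ 4 * (b ^ 2 * J) := by
          simp only [hT, pow_zero, div_one]
          refine h4.trans ?_
          rw [hJ]
          gcongr
          refine ball_subset_ball' ?_
          rw [dist_eq_norm]
          linarith
        rw [enorm_sq_eq_ofReal, ENNReal.ofReal_le_iff_le_toReal (by finiteness)] at h5
        simpa using h5
      have hcont : Continuous (T 0) :=
        ((hf.ballSmoothing (hlk 0)).ballSmoothing (hlk 0)).continuous
      obtain ⟨A, hA⟩ := exists_affineMap_abs_sub_le hcont (by positivity) hsd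
      refine ⟨A, fun x hx => ?_⟩
      have h1 := hA x (ball_subset_closedBall hx)
      have h2 : (T 0 x - A x) ^ 2 ≤ 64 * n ^ 2 * (b ^ 2 * J).toReal := by
        rw [← sq_abs]
        calc |T 0 x - A x| ^ 2 ≤ (4 * n * √(4 * (b ^ 2 * J).toReal)) ^ 2 := by gcongr
          _ = _ := by
            rw [mul_pow, Real.sq_sqrt (by positivity)]
            ring
      rw [enorm_sq_eq_ofReal]
      refine (ENNReal.ofReal_le_ofReal h2).trans_eq ?_
      rw [ENNReal.ofReal_mul (by positivity), ENNReal.ofReal_toReal hfin,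
        ENNReal.ofReal_mul (by norm_num), ENNReal.ofReal_pow (by positivity)]
      simp
  obtain ⟨A, hA⟩ := haff
  refine ⟨A, fun x hx => ?_⟩
  have h1 : f x - A x = (f x - T 0 x) + (T 0 x - A x) := by ring
  rw [h1, mul_assoc 2, add_mul]
  refine (enorm_add_sq_le _ _).trans ?_
  gcongr
  · exact htele x
  · exact (hA x hx).trans (mul_le_mul_right (hJB x hx) _)

/-- Minkowski's inequality for a series. -/
theorem lintegral_rpow_tsum_le {α : Type*} [MeasurableSpace α] {μ : Measure α} {q : ℝ} (hq : 1 ≤ q)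
    {F : ℕ → α → ℝ≥0∞} (hF : ∀ k, Measurable (F k)) :
    (∫⁻ x, (∑' k, F k x) ^ q ∂μ) ^ (1 / q) ≤ ∑' k, (∫⁻ x, F k x ^ q ∂μ) ^ (1 / q) := by
  have hq0 : 0 < q := by linarith
  have hfin : ∀ N, (∫⁻ x, (∑ k ∈ Finset.range N, F k x) ^ q ∂μ) ^ (1 / q) ≤
      ∑ k ∈ Finset.range N, (∫⁻ x, F k x ^ q ∂μ) ^ (1 / q) := by
    intro N
    induction N with
    | zero => simp [hq0]
    | succ N ih =>
      simp_rw [Finset.sum_range_succ]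
      refine (ENNReal.lintegral_Lp_add_le (Finset.measurable_fun_sum _ fun k _ => hF k).aemeasurable
        (hF N).aemeasurable hq).trans ?_
      gcongr
  have hsup : ∀ x, (∑' k, F k x) ^ q = ⨆ N, (∑ k ∈ Finset.range N, F k x) ^ q := by
    intro x
    rw [ENNReal.tsum_eq_iSup_nat]
    exact (ENNReal.orderIsoRpow q hq0).map_iSup _
  simp_rw [hsup]
  rw [lintegral_iSup (fun N => (Finset.measurable_fun_sum _ fun k _ => hF k).pow_const q)
    (fun N M h x => by dsimp only; gcongr)]
  rw [one_div, ENNReal.rpow_inv_le_iff hq0]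
  refine iSup_le fun N => ?_
  rw [← ENNReal.rpow_inv_le_iff hq0, ← one_div]
  exact (hfin N).trans (ENNReal.sum_le_tsum _)

section BallMeans

variable {E : Type*} [NormedAddCommGroup E] [NormedSpace ℝ E] [FiniteDimensional ℝ E]
  [MeasureSpace E] [BorelSpace E] [(volume : Measure E).IsAddHaarMeasure]

theorem measurable_setLIntegral_ball {W : E → ℝ≥0∞} (hW : Measurable W) (t : ℝ) :
    Measurable fun x => ∫⁻ z in ball x t, W z := by
  have h1 : ∀ x, ∫⁻ z in ball x t, W z = ∫⁻ v in ball (0 : E) t, W (x + v) := fun x => by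
    rw [setLIntegral_ball_comp_add_left, add_zero]
  simp_rw [h1]
  have : Measurable fun q : E × E => W (q.1 + q.2) := hW.comp measurable_add
  exact this.lintegral_prod_right'

theorem setLIntegral_setLIntegral_ball_le {W : E → ℝ≥0∞} (hW : Measurable W) (c : E) (r t : ℝ) :
    ∫⁻ x in ball c r, ∫⁻ z in ball x t, W z ≤
      volume (ball (0 : E) t) * ∫⁻ z in ball c (r + t), W z := by
  have h1 : ∀ x, ∫⁻ z in ball x t, W z = ∫⁻ v in ball (0 : E) t, W (x + v) := fun x => by
    rw [setLIntegral_ball_comp_add_left, add_zero]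
  have hm : Measurable fun q : E × E => W (q.1 + q.2) := hW.comp measurable_add
  simp_rw [h1]
  rw [lintegral_lintegral_swap hm.aemeasurable, mul_comm, ← setLIntegral_const]
  refine setLIntegral_mono measurable_const fun v hv => ?_
  rw [setLIntegral_ball_comp_add_right]
  refine lintegral_mono_set (ball_subset_ball' ?_)
  have := mem_ball_zero_iff.1 hv
  rw [dist_eq_norm, add_sub_cancel_left]
  linarith

/-- Means over balls of radius `t` gain integrability, at the cost of a power of `t`. -/
theorem setLIntegral_ball_rpow_le {W : E → ℝ≥0∞} (hW : Measurable W) (c : E) {r t q : ℝ}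
    (hq : 1 ≤ q) :
    (∫⁻ x in ball c r, (∫⁻ z in ball x t, W z) ^ q) ^ (1 / q) ≤
      volume (ball (0 : E) t) ^ (1 / q) * ∫⁻ z in ball c (r + t), W z := by
  have hq0 : 0 < q := by linarith
  set J := ∫⁻ z in ball c (r + t), W z with hJ
  have h1 : ∫⁻ x in ball c r, (∫⁻ z in ball x t, W z) ^ q ≤ J ^ q * volume (ball (0 : E) t) := by
    calc ∫⁻ x in ball c r, (∫⁻ z in ball x t, W z) ^ q
        ≤ ∫⁻ x in ball c r, J ^ (q - 1) * ∫⁻ z in ball x t, W z := by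
          refine setLIntegral_mono ((measurable_setLIntegral_ball hW t).const_mul _) fun x hx => ?_
          have h2 : ∫⁻ z in ball x t, W z ≤ J :=
            lintegral_mono_set (ball_subset_ball' (by linarith [mem_ball.1 hx]))
          calc (∫⁻ z in ball x t, W z) ^ q
              = (∫⁻ z in ball x t, W z) ^ (q - 1) * ∫⁻ z in ball x t, W z := by
                conv_lhs => rw [← sub_add_cancel q 1]
                rw [ENNReal.rpow_add_of_nonneg _ _ (by linarith) zero_le_one, ENNReal.rpow_one]
            _ ≤ _ := by
                gcongr
      _ = J ^ (q - 1) * ∫⁻ x in ball c r, ∫⁻ z in ball x t, W z :=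
          lintegral_const_mul _ (measurable_setLIntegral_ball hW t)
      _ ≤ J ^ (q - 1) * (volume (ball (0 : E) t) * J) := by
          gcongr
          exact setLIntegral_setLIntegral_ball_le hW c r t
      _ = J ^ q * volume (ball (0 : E) t) := by
          conv_rhs => rw [← sub_add_cancel q 1]
          rw [ENNReal.rpow_add_of_nonneg _ _ (by linarith) zero_le_one, ENNReal.rpow_one]
          ring
  calc _ ≤ (J ^ q * volume (ball (0 : E) t)) ^ (1 / q) := by gcongr
    _ = _ := by
      rw [ENNReal.mul_rpow_of_nonneg _ _ (by positivity), ← ENNReal.rpow_mul,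
        mul_one_div_cancel hq0.ne', ENNReal.rpow_one, mul_comm]

end BallMeans

end

/-! ### The local estimate for the coefficients -/

noncomputable section

open Metric Module

variable {n : ℕ} {L : ℝ≥0} {f : EuclideanSpace ℝ (Fin n) → ℝ}

/-- For sets which are not larger than their diameter allows, `β_p ≤ β_2` when `p < 2`. -/
theorem betaNumber_le_betaNumber_two (hf : Continuous f) {p : ℝ≥0∞} (hp1 : 1 ≤ p) (hp2 : p < 2)
    {S : Set (EuclideanSpace ℝ (Fin n))} (hS : volume S ≤ ediam S ^ n) :
    betaNumber f p S ≤ betaNumber f 2 S := by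
  have hptop : p ≠ ∞ := (hp2.trans (by simp)).ne
  have hpr1 : 1 ≤ p.toReal := by
    rw [← ENNReal.toReal_one]; exact ENNReal.toReal_mono hptop hp1
  have hpr2 : p.toReal < 2 := by
    rw [← ENNReal.toReal_ofNat 2]; exact ENNReal.toReal_strict_mono (by simp) hp2
  rw [betaNumber, betaNumber, if_neg hptop, if_neg (by simp)]
  refine iInf_mono fun A => ?_
  have hg : Measurable fun x => ‖f x - A x‖ₑ / ediam S := by
    have := A.continuous_of_finiteDimensional
    fun_prop
  set g := fun x => ‖f x - A x‖ₑ / ediam S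
  set μ : Measure (EuclideanSpace ℝ (Fin n)) := (ediam S ^ n)⁻¹ • volume.restrict S with hμ
  have hμ1 : μ Set.univ ≤ 1 := by
    rw [hμ, Measure.smul_apply, Measure.restrict_apply_univ, smul_eq_mul, mul_comm, ← div_eq_mul_inv]
    exact ENNReal.div_le_of_le_mul (by simpa using hS)
  have hint : ∀ q : ℝ, (∫⁻ x in S, g x ^ q) / ediam S ^ n = ∫⁻ x, g x ^ q ∂μ := by
    intro q
    rw [hμ, lintegral_smul_measure, smul_eq_mul, div_eq_mul_inv, mul_comm]
  change ((∫⁻ x in S, g x ^ p.toReal) / _) ^ _ ≤ ((∫⁻ x in S, g x ^ (2 : ℝ≥0∞).toReal) / _) ^ _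
  rw [hint, hint, ENNReal.toReal_ofNat]
  have hr : 0 < (1 / p.toReal - 1 / 2)⁻¹ := by
    refine inv_pos.2 (sub_pos.2 ?_)
    gcongr
  have h := ENNReal.lintegral_Lp_mul_le_Lq_mul_Lr (p := p.toReal) (q := 2)
    (r := (1 / p.toReal - 1 / 2)⁻¹) (by linarith) hpr2 (by rw [one_div (1 / p.toReal - 1 / 2)⁻¹, inv_inv]; ring)
    μ hg.aemeasurable (aemeasurable_const (b := (1 : ℝ≥0∞)))
  simp only [Pi.mul_apply, mul_one, ENNReal.one_rpow, lintegral_const, one_mul] at h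
  refine h.trans (mul_le_of_le_one_right' ?_)
  exact ENNReal.rpow_le_one hμ1 (by positivity)

theorem le_rpow_half_iff {a b : ℝ≥0∞} : a ≤ b ^ (1 / 2 : ℝ) ↔ a ^ 2 ≤ b := by
  rw [one_div, ENNReal.le_rpow_inv_iff (by norm_num)]
  norm_num

/-- Passing from a pointwise multiscale bound by local means to a bound of `β_p ²`, for
`2 ≤ p ≤ ∞`. Here `2 / p.toReal = 0` if `p = ∞`. -/
theorem betaNumber_sq_le_tsum {p : ℝ≥0∞} (hp : 2 ≤ p)
    {S : Set (EuclideanSpace ℝ (Fin n))} {c : EuclideanSpace ℝ (Fin n)} {ρ : ℝ} {d M : ℝ≥0∞}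
    (hd0 : d ≠ 0) (hd : d ≠ ∞)
    (hSc : S ⊆ ball c ρ) (hSd : d ≤ ediam S) (A : EuclideanSpace ℝ (Fin n) →ᵃ[ℝ] ℝ)
    {w : ℕ → ℝ≥0∞} (hw : ∀ k, w k ≠ ∞) {t : ℕ → ℝ} {W : ℕ → EuclideanSpace ℝ (Fin n) → ℝ≥0∞}
    (hW : ∀ k, Measurable (W k))
    (hA : ∀ x ∈ ball c ρ, ‖f x - A x‖ₑ ^ 2 ≤ M * ∑' k, w k * ∫⁻ z in ball x (t k), W k z) :
    betaNumber f p S ^ 2 ≤ (d ^ (2 + n * (2 / p.toReal)))⁻¹ * (M * ∑' k, w k *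
      (volume (ball (0 : EuclideanSpace ℝ (Fin n)) (t k)) ^ (2 / p.toReal) *
        ∫⁻ z in ball c (ρ + t k), W k z)) := by
  by_cases hptop : p = ∞
  · rw [betaNumber, if_pos hptop]
    simp only [hptop, ENNReal.toReal_top, div_zero, mul_zero, add_zero, ENNReal.rpow_zero, one_mul]
    rw [← le_rpow_half_iff]
    refine (iInf_le _ A).trans (iSup₂_le fun x hx => ?_)
    rw [le_rpow_half_iff, ENNReal.rpow_ofNat, ENNReal.div_eq_inv_mul, mul_pow, ← ENNReal.inv_pow]
    gcongr
    refine (hA x (hSc hx)).trans ?_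
    gcongr with k
    exact ball_subset_ball' (by linarith [mem_ball.1 (hSc hx)])
  · have hpr2 : 2 ≤ p.toReal := by
      rw [← ENNReal.toReal_ofNat 2]; exact ENNReal.toReal_mono hptop hp
    set q := p.toReal / 2 with hq
    have hq1 : 1 ≤ q := by rw [hq]; linarith
    have hq0 : 0 < q := by linarith
    have hpq : p.toReal = 2 * q := by rw [hq]; ring
    have hκ : 2 / p.toReal = 1 / q := by rw [hpq]; field_simp
    set G : EuclideanSpace ℝ (Fin n) → ℝ≥0∞ :=
      fun x => ∑' k, w k * ∫⁻ z in ball x (t k), W k z with hG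
    have hGm : ∀ k, Measurable fun x => w k * ∫⁻ z in ball x (t k), W k z :=
      fun k => (measurable_setLIntegral_ball (hW k) (t k)).const_mul _
    -- Minkowski's inequality in the space of exponent `p / 2`
    have hGq : (∫⁻ x in ball c ρ, G x ^ q) ^ (1 / q) ≤
        ∑' k, w k * (volume (ball (0 : EuclideanSpace ℝ (Fin n)) (t k)) ^ (1 / q) *
          ∫⁻ z in ball c (ρ + t k), W k z) := by
      refine (lintegral_rpow_tsum_le hq1 hGm).trans ?_
      gcongr with k
      calc (∫⁻ x in ball c ρ, (w k * ∫⁻ z in ball x (t k), W k z) ^ q) ^ (1 / q)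
          = (w k ^ q * ∫⁻ x in ball c ρ, (∫⁻ z in ball x (t k), W k z) ^ q) ^ (1 / q) := by
            simp_rw [ENNReal.mul_rpow_of_nonneg _ _ hq0.le]
            rw [lintegral_const_mul' _ _ (ENNReal.rpow_ne_top_of_nonneg hq0.le (hw k))]
        _ = w k * (∫⁻ x in ball c ρ, (∫⁻ z in ball x (t k), W k z) ^ q) ^ (1 / q) := by
            rw [ENNReal.mul_rpow_of_nonneg _ _ (by positivity), ← ENNReal.rpow_mul,
              mul_one_div_cancel hq0.ne', ENNReal.rpow_one]
        _ ≤ _ := by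
            gcongr
            exact setLIntegral_ball_rpow_le (hW k) c hq1
    have hpt : ∀ x ∈ S, (‖f x - A x‖ₑ / ediam S) ^ p.toReal ≤
        (d ^ p.toReal)⁻¹ * (M ^ q * G x ^ q) := by
      intro x hx
      rw [ENNReal.div_eq_inv_mul, ENNReal.mul_rpow_of_nonneg _ _ (by linarith), ENNReal.inv_rpow]
      gcongr ?_ * ?_
      · gcongr
      · rw [hpq, ENNReal.rpow_mul, ENNReal.rpow_ofNat, ← ENNReal.mul_rpow_of_nonneg _ _ hq0.le]
        exact ENNReal.rpow_le_rpow (hA x (hSc hx)) hq0.le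
    have hGmeas : Measurable G := Measurable.tsum hGm
    have hint : (∫⁻ x in S, (‖f x - A x‖ₑ / ediam S) ^ p.toReal) / ediam S ^ n ≤
        (d ^ (p.toReal + n))⁻¹ * (M ^ q * ∫⁻ x in ball c ρ, G x ^ q) := by
      calc (∫⁻ x in S, (‖f x - A x‖ₑ / ediam S) ^ p.toReal) / ediam S ^ n
          ≤ (∫⁻ x in S, (d ^ p.toReal)⁻¹ * (M ^ q * G x ^ q)) / d ^ n := by
            gcongr ?_ / ?_
            · exact setLIntegral_mono (by fun_prop) hpt
            · gcongr
        _ ≤ (∫⁻ x in ball c ρ, (d ^ p.toReal)⁻¹ * (M ^ q * G x ^ q)) / d ^ n := by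
            gcongr
        _ = _ := by
            rw [lintegral_const_mul _ (by fun_prop), lintegral_const_mul _ (by fun_prop),
              ENNReal.rpow_add _ _ hd0 hd, ENNReal.rpow_natCast, ENNReal.div_eq_inv_mul,
              ENNReal.mul_inv (Or.inr (by finiteness)) (Or.inr (by simp [hd0]))]
            ring
    have hbeta : betaNumber f p S ≤
        ((d ^ (p.toReal + n))⁻¹ * (M ^ q * ∫⁻ x in ball c ρ, G x ^ q)) ^ (1 / p.toReal) := by
      rw [betaNumber, if_neg hptop]
      refine (iInf_le _ A).trans ?_
      gcongr
    calc betaNumber f p S ^ 2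
        ≤ (((d ^ (p.toReal + n))⁻¹ * (M ^ q * ∫⁻ x in ball c ρ, G x ^ q)) ^ (1 / p.toReal)) ^ 2 := by
          gcongr
      _ = (d ^ (2 + n * (2 / p.toReal)))⁻¹ * (M * (∫⁻ x in ball c ρ, G x ^ q) ^ (1 / q)) := by
          rw [← ENNReal.rpow_ofNat, ← ENNReal.rpow_mul, one_div_mul_eq_div, hκ,
            ENNReal.mul_rpow_of_nonneg _ _ (by positivity),
            ENNReal.mul_rpow_of_nonneg _ _ (by positivity), ENNReal.inv_rpow, ← ENNReal.rpow_mul,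
            ← ENNReal.rpow_mul, mul_one_div_cancel hq0.ne', ENNReal.rpow_one]
          congr 3
          rw [hpq]
          field_simp
      _ ≤ _ := by
          rw [hκ]
          gcongr

/-- The powers of `l` cancel, and the weight `θ⁻ᵏ` turns the decay `θ²ᵏ` of the `k`-th scale into
`θᵏ`, where `θ = 2 ^ (-ε / 2)` and `ε = 2 - n + n κ`. -/
theorem scale_weight_eq {l κ : ℝ} (hl : 0 < l) (k : ℕ) :
    (l ^ (2 + n * κ))⁻¹ * (((2 : ℝ) ^ (-(2 - n + n * κ) / 2)) ^ k)⁻¹ * ((((l / 2 ^ k) ^ n)⁻¹) ^ 2) *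
      ((l / 2 ^ k) ^ n) ^ κ * (l / 2 ^ k) ^ (n + 2) * l ^ n =
    ((2 : ℝ) ^ (-(2 - n + n * κ) / 2)) ^ k := by
  have h2 : (0 : ℝ) < 2 := two_pos
  set θ := (2 : ℝ) ^ (-(2 - n + n * κ) / 2) with hθ
  have hθ0 : 0 < θ := by positivity
  set u : ℝ := 2 ^ k with hu
  have hu0 : 0 < u := by positivity
  have e1 : ((l / u) ^ n) ^ κ = l ^ (n * κ) / (u ^ n) ^ κ := by
    rw [div_pow, Real.div_rpow (by positivity) (by positivity), Real.rpow_mul hl.le,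
      Real.rpow_natCast]
  have e2 : l ^ (2 + n * κ) = l ^ 2 * l ^ (n * κ) := by
    rw [Real.rpow_add hl, Real.rpow_ofNat]
  have e3 : (θ ^ k) ^ 2 * (u ^ 2 * (u ^ n) ^ κ) = u ^ n := by
    rw [hθ, hu]
    simp only [← Real.rpow_natCast, ← Real.rpow_mul h2.le, ← Real.rpow_add h2]
    congr 1
    push_cast
    ring
  have hU : 0 < (u ^ n) ^ κ := by positivity
  have hl1 : 0 < l ^ (n * κ) := by positivity
  rw [e1, e2]
  set U := (u ^ n) ^ κ
  set Λ := l ^ (n * κ)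
  have h4 : (l ^ 2 * Λ)⁻¹ * (θ ^ k)⁻¹ * (((l / u) ^ n)⁻¹) ^ 2 * (Λ / U) * (l / u) ^ (n + 2) * l ^ n =
      u ^ n / (θ ^ k * (u ^ 2 * U)) := by
    rw [div_pow, div_pow]
    field_simp
    ring
  rw [h4, ← e3]
  field_simp

/-- **Local estimate.** The coefficient `β_p` of a set of size `l` is bounded by the second
differences of `f` at all dyadic scales below `l`, with geometrically decaying weights. The decay
is where the Sobolev range `n (1 / 2 - 1 / p) < 1` of the exponent enters. -/
theorem exists_betaNumber_sq_mul_le {p : ℝ≥0∞} (hp : 2 ≤ p)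
    (hε : 0 < 2 - (n : ℝ) + n * (2 / p.toReal)) {D : ℝ} (hD : 0 < D) :
    ∃ M : ℝ≥0∞, M ≠ ∞ ∧ ∀ (L : ℝ≥0) (f : EuclideanSpace ℝ (Fin n) → ℝ), LipschitzWith L f →
      ∀ (c : EuclideanSpace ℝ (Fin n)) (l : ℝ), 0 < l → ∀ S : Set (EuclideanSpace ℝ (Fin n)),
        S ⊆ ball c (D * l) → ENNReal.ofReal l ≤ ediam S →
        betaNumber f p S ^ 2 * ENNReal.ofReal (l ^ n) ≤ M * ∑' k : ℕ,
          ENNReal.ofReal (((2 : ℝ) ^ (-(2 - n + n * (2 / p.toReal)) / 2)) ^ k) *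
            ∫⁻ x in ball c ((3 * D + 2) * l), ENNReal.ofReal (((l / 2 ^ k) ^ (n + 2))⁻¹) *
              secondDiffEnergy f ((D + 1) * (l / 2 ^ k)) x := by
  set κ := 2 / p.toReal with hκ
  have hκ0 : 0 ≤ κ := by positivity
  -- half of the decay exponent pays for the weights of the Cauchy-Schwarz inequality
  set θ := (2 : ℝ) ^ (-(2 - n + n * κ) / 2) with hθ
  have hθ0 : 0 < θ := by positivity
  have hθ1 : θ < 1 := Real.rpow_lt_one_of_one_lt_of_neg one_lt_two (by linarith)
  set ω := volume (ball (0 : EuclideanSpace ℝ (Fin n)) 1) with hω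
  have hω0 : ω ≠ 0 := (measure_ball_pos _ _ one_pos).ne'
  have hωt : ω ≠ ∞ := measure_ball_lt_top.ne
  set M₀ : ℝ≥0∞ := 2 * (ENNReal.ofReal ((1 - θ)⁻¹) * (4 * (1 + 2 ^ n) ^ 2) + 64 * n ^ 2) with hM₀
  have hM₀t : M₀ ≠ ∞ := by finiteness
  set M₁ : ℝ≥0∞ := ω⁻¹ ^ 2 * (ENNReal.ofReal ((2 * (D + 1)) ^ n) * ω) ^ κ with hM₁
  have hM₁t : M₁ ≠ ∞ := by
    refine ENNReal.mul_ne_top (ENNReal.pow_ne_top (ENNReal.inv_ne_top.2 hω0)) ?_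
    exact ENNReal.rpow_ne_top_of_nonneg hκ0 (by finiteness)
  refine ⟨M₀ * M₁, ENNReal.mul_ne_top hM₀t hM₁t, fun L f hf c l hl S hS hdiam => ?_⟩
  have hlk : ∀ k : ℕ, 0 < l / 2 ^ k := fun k => by positivity
  have hlk1 : ∀ k : ℕ, l / 2 ^ k ≤ l := fun k => div_le_self hl.le (one_le_pow₀ one_le_two)
  have hvol : ∀ r : ℝ, 0 < r → volume (ball (0 : EuclideanSpace ℝ (Fin n)) r) =
      ENNReal.ofReal (r ^ n) * ω := by
    intro r hr
    rw [Measure.addHaar_ball_of_pos _ _ hr, finrank_euclideanSpace_fin]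
  obtain ⟨A, hA⟩ := exists_affineMap_enorm_sub_sq_le hf c hD hl hθ0 hθ1
  have hβ := betaNumber_sq_le_tsum (f := f) hp (d := ENNReal.ofReal l) (by simpa using hl)
    (by finiteness) hS hdiam A (M := M₀)
    (w := fun k : ℕ => ENNReal.ofReal ((θ ^ k)⁻¹) *
      (volume (ball (0 : EuclideanSpace ℝ (Fin n)) (l / 2 ^ k)))⁻¹ ^ 2)
    (fun k => ENNReal.mul_ne_top (by finiteness) (ENNReal.pow_ne_top
      (ENNReal.inv_ne_top.2 (measure_ball_pos _ _ (hlk k)).ne')))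
    (t := fun k : ℕ => 2 * (D + 1) * (l / 2 ^ k))
    (W := fun k : ℕ => secondDiffEnergy f ((D + 1) * (l / 2 ^ k)))
    (fun k => measurable_secondDiffEnergy hf.continuous _)
    (fun x hx => (hA x hx).trans_eq (by simp only [hM₀, mul_assoc]))
  rw [← hκ] at hβ
  set I : ℕ → ℝ≥0∞ := fun k => ∫⁻ x in ball c ((3 * D + 2) * l),
    ENNReal.ofReal (((l / 2 ^ k) ^ (n + 2))⁻¹) *
      secondDiffEnergy f ((D + 1) * (l / 2 ^ k)) x with hI
  have hJ : ∀ k : ℕ, ∫⁻ z in ball c (D * l + 2 * (D + 1) * (l / 2 ^ k)),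
      secondDiffEnergy f ((D + 1) * (l / 2 ^ k)) z ≤
        ENNReal.ofReal ((l / 2 ^ k) ^ (n + 2)) * I k := by
    intro k
    simp only [hI]
    rw [lintegral_const_mul _ (measurable_secondDiffEnergy hf.continuous _), ← mul_assoc,
      ← ENNReal.ofReal_mul (by positivity), mul_inv_cancel₀ (by positivity), ENNReal.ofReal_one,
      one_mul]
    refine lintegral_mono_set (ball_subset_ball ?_)
    nlinarith [hlk1 k]
  have hterm : ∀ k : ℕ, (ENNReal.ofReal l ^ (2 + n * κ))⁻¹ * (ENNReal.ofReal ((θ ^ k)⁻¹) *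
      (volume (ball (0 : EuclideanSpace ℝ (Fin n)) (l / 2 ^ k)))⁻¹ ^ 2 *
      (volume (ball (0 : EuclideanSpace ℝ (Fin n)) (2 * (D + 1) * (l / 2 ^ k))) ^ κ *
        ENNReal.ofReal ((l / 2 ^ k) ^ (n + 2)))) * ENNReal.ofReal (l ^ n) =
      M₁ * ENNReal.ofReal (θ ^ k) := by
    intro k
    have ht := hlk k
    have hs := congrArg ENNReal.ofReal (scale_weight_eq (n := n) (κ := κ) hl k)
    rw [← hθ, ENNReal.ofReal_mul (by positivity), ENNReal.ofReal_mul (by positivity),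
      ENNReal.ofReal_mul (by positivity), ENNReal.ofReal_mul (by positivity),
      ENNReal.ofReal_mul (by positivity)] at hs
    have a1 : (ENNReal.ofReal l ^ (2 + n * κ))⁻¹ = ENNReal.ofReal ((l ^ (2 + n * κ))⁻¹) := by
      rw [ENNReal.ofReal_rpow_of_pos hl, ENNReal.ofReal_inv_of_pos (by positivity)]
    have a2 : (volume (ball (0 : EuclideanSpace ℝ (Fin n)) (l / 2 ^ k)))⁻¹ ^ 2 =
        ENNReal.ofReal ((((l / 2 ^ k) ^ n)⁻¹) ^ 2) * ω⁻¹ ^ 2 := by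
      rw [hvol _ ht, ENNReal.mul_inv (Or.inr hωt) (Or.inr hω0), mul_pow,
        ENNReal.ofReal_pow (by positivity) 2, ENNReal.ofReal_inv_of_pos (by positivity)]
    have a3 : volume (ball (0 : EuclideanSpace ℝ (Fin n)) (2 * (D + 1) * (l / 2 ^ k))) ^ κ =
        (ENNReal.ofReal ((2 * (D + 1)) ^ n) * ω) ^ κ * ENNReal.ofReal (((l / 2 ^ k) ^ n) ^ κ) := by
      rw [hvol _ (by positivity), mul_pow (2 * (D + 1)), ENNReal.ofReal_mul (by positivity),
        mul_right_comm, ENNReal.mul_rpow_of_nonneg _ _ hκ0,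
        ENNReal.ofReal_rpow_of_pos (by positivity)]
    rw [a1, a2, a3, ← hs, hM₁]
    ring
  calc betaNumber f p S ^ 2 * ENNReal.ofReal (l ^ n)
      ≤ (ENNReal.ofReal l ^ (2 + n * κ))⁻¹ * (M₀ * ∑' k : ℕ, (ENNReal.ofReal ((θ ^ k)⁻¹) *
        (volume (ball (0 : EuclideanSpace ℝ (Fin n)) (l / 2 ^ k)))⁻¹ ^ 2) *
        (volume (ball (0 : EuclideanSpace ℝ (Fin n)) (2 * (D + 1) * (l / 2 ^ k))) ^ κ *
          (ENNReal.ofReal ((l / 2 ^ k) ^ (n + 2)) * I k))) * ENNReal.ofReal (l ^ n) := by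
        refine mul_le_mul_left (hβ.trans ?_) _
        gcongr with k
        exact hJ k
    _ = M₀ * ∑' k : ℕ, ((ENNReal.ofReal l ^ (2 + n * κ))⁻¹ * (ENNReal.ofReal ((θ ^ k)⁻¹) *
        (volume (ball (0 : EuclideanSpace ℝ (Fin n)) (l / 2 ^ k)))⁻¹ ^ 2 *
        (volume (ball (0 : EuclideanSpace ℝ (Fin n)) (2 * (D + 1) * (l / 2 ^ k))) ^ κ *
          ENNReal.ofReal ((l / 2 ^ k) ^ (n + 2)))) * ENNReal.ofReal (l ^ n)) * I k := by
        rw [mul_left_comm, mul_assoc, ← ENNReal.tsum_mul_left, ← ENNReal.tsum_mul_right]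
        congr 1
        refine tsum_congr fun k => ?_
        ring
    _ = M₀ * M₁ * ∑' k : ℕ, ENNReal.ofReal (θ ^ k) * I k := by
        simp_rw [hterm]
        rw [mul_assoc M₀ M₁, ← ENNReal.tsum_mul_left (a := M₁)]
        congr 1
        refine tsum_congr fun k => ?_
        ring

end

/-! ### Dyadic cubes and summation over the scales -/

noncomputable section

open Metric Module

section Boxes

variable {n : ℕ}

theorem measurableSet_box (a b : Fin n → ℝ) :
    MeasurableSet {x : EuclideanSpace ℝ (Fin n) | ∀ i, x i ∈ Set.Ico (a i) (b i)} := by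
  simp only [Set.ofPred_forall]
  refine MeasurableSet.iInter fun i => ?_
  exact measurableSet_Ico.preimage (by fun_prop : Measurable fun x : EuclideanSpace ℝ (Fin n) => x i)

theorem volume_box (a b : Fin n → ℝ) :
    volume {x : EuclideanSpace ℝ (Fin n) | ∀ i, x i ∈ Set.Ico (a i) (b i)} =
      ∏ i, ENNReal.ofReal (b i - a i) := by
  rw [← Real.volume_pi_Ico, ← (EuclideanSpace.volume_preserving_symm_measurableEquiv_toLp
    (Fin n)).measure_preimage_equiv]
  congr 1
  ext x
  simp [Set.mem_pi]

theorem volume_axisCube (c : EuclideanSpace ℝ (Fin n)) (s : ℝ) :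
    volume (axisCube c s) = ENNReal.ofReal s ^ n := by
  rw [axisCube, volume_box]
  simp only [add_sub_sub_cancel, add_halves, Finset.prod_const, Finset.card_univ, Fintype.card_fin]

theorem axisCube_subset_ball (hn : 1 ≤ n) (c : EuclideanSpace ℝ (Fin n)) {s : ℝ} (hs : 0 < s) :
    axisCube c s ⊆ ball c (√n * s) := by
  intro x hx
  have hn' : (0 : ℝ) < n := by exact_mod_cast hn
  rw [mem_ball, EuclideanSpace.dist_eq]
  have h1 : ∑ i, dist (x i) (c i) ^ 2 ≤ n * (s / 2) ^ 2 := by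
    calc ∑ i, dist (x i) (c i) ^ 2 ≤ ∑ _i : Fin n, (s / 2) ^ 2 := by
          refine Finset.sum_le_sum fun i _ => ?_
          have h2 := hx i
          have h3 : dist (x i) (c i) ≤ s / 2 := by
            rw [Real.dist_eq, abs_le]
            constructor <;> linarith [h2.1, h2.2]
          gcongr
      _ = _ := by simp
  calc √(∑ i, dist (x i) (c i) ^ 2) ≤ √(n * (s / 2) ^ 2) := Real.sqrt_le_sqrt h1
    _ = √n * (s / 2) := by rw [Real.sqrt_mul (by positivity), Real.sqrt_sq (by positivity)]
    _ < √n * s := by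
      gcongr
      linarith

theorem ofReal_le_ediam_axisCube (hn : 1 ≤ n) (c : EuclideanSpace ℝ (Fin n)) {s : ℝ} :
    ENNReal.ofReal s ≤ ediam (axisCube c s) := by
  refine le_of_forall_lt fun a ha => ?_
  obtain ⟨r, hr0, har, hrs⟩ : ∃ r : ℝ, 0 ≤ r ∧ a < ENNReal.ofReal r ∧ r < s := by
    obtain ⟨b, hab, hbs⟩ := exists_between ha
    have hb : b ≠ ∞ := hbs.ne_top
    refine ⟨b.toReal, ENNReal.toReal_nonneg, by rwa [ENNReal.ofReal_toReal hb], ?_⟩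
    rw [← ENNReal.ofReal_toReal hb] at hbs
    exact (ENNReal.ofReal_lt_ofReal_iff_of_nonneg ENNReal.toReal_nonneg).1 hbs
  -- the lower corner, and its translate by `r` in the first coordinate direction
  let i₀ : Fin n := ⟨0, hn⟩
  let x : EuclideanSpace ℝ (Fin n) := WithLp.toLp 2 fun i => c i - s / 2
  let y : EuclideanSpace ℝ (Fin n) := x + EuclideanSpace.single i₀ r
  have hx : x ∈ axisCube c s := fun i => ⟨le_rfl, by simp only [x]; linarith⟩
  have hy : y ∈ axisCube c s := by
    intro i
    by_cases h : i = i₀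
    · subst h
      simp only [y, x, PiLp.add_apply, PiLp.single_apply, if_true, Set.mem_Ico]
      constructor <;> linarith
    · simp only [y, x, PiLp.add_apply, PiLp.single_apply, if_neg h, Set.mem_Ico, add_zero]
      constructor <;> linarith
  refine har.trans_le (le_trans (le_of_eq ?_) (edist_le_ediam_of_mem hy hx))
  rw [edist_dist, dist_eq_norm, add_sub_cancel_left]
  simp [abs_of_nonneg hr0]

end Boxes

namespace DyadicCube

variable {n : ℕ}

theorem side_pos (Q : DyadicCube n) : 0 < Q.side := zpow_pos two_pos _

theorem toSet_eq_axisCube (Q : DyadicCube n) : Q.toSet = axisCube Q.center Q.side := by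
  ext x
  simp only [toSet, axisCube, center, Set.mem_ofPred_eq]
  refine forall_congr' fun i => ?_
  have h1 : ((Q.pos i : ℝ) + 1 / 2) * Q.side - Q.side / 2 = Q.pos i * Q.side := by ring
  have h2 : ((Q.pos i : ℝ) + 1 / 2) * Q.side + Q.side / 2 = (Q.pos i + 1) * Q.side := by ring
  rw [h1, h2]

theorem measurableSet_toSet (Q : DyadicCube n) : MeasurableSet Q.toSet := measurableSet_box _ _

theorem volume_toSet (Q : DyadicCube n) : volume Q.toSet = ENNReal.ofReal (Q.side ^ n) := by
  rw [toSet_eq_axisCube, volume_axisCube, ENNReal.ofReal_pow Q.side_pos.le]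

theorem toSet_subset_ball (hn : 1 ≤ n) (Q : DyadicCube n) :
    Q.toSet ⊆ ball Q.center (√n * Q.side) := by
  rw [toSet_eq_axisCube]
  exact axisCube_subset_ball hn _ Q.side_pos

theorem gen_le_of_subset (hn : 1 ≤ n) {Q Q' : DyadicCube n} (h : Q.toSet ⊆ Q'.toSet) :
    Q'.gen ≤ Q.gen := by
  have h1 := measure_mono (μ := volume) h
  have hs := Q.side_pos
  have hs' := Q'.side_pos
  rw [volume_toSet, volume_toSet, ENNReal.ofReal_le_ofReal_iff (by positivity),
    pow_le_pow_iff_left₀ hs.le hs'.le (by omega), side, side,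
    zpow_le_zpow_iff_right₀ one_lt_two] at h1
  omega

theorem side_mk_add (j : ℤ) (m : ℕ) (k k' : Fin n → ℤ) :
    (⟨j + m, k⟩ : DyadicCube n).side = (⟨j, k'⟩ : DyadicCube n).side / 2 ^ m := by
  simp only [side]
  rw [neg_add, zpow_add₀ two_ne_zero, zpow_neg 2 (m : ℤ), zpow_natCast]
  rfl

theorem pairwise_disjoint_toSet (j : ℤ) :
    Pairwise (Function.onFun Disjoint fun k : Fin n → ℤ => (⟨j, k⟩ : DyadicCube n).toSet) := by
  intro k k' hkk
  rw [Function.onFun, Set.disjoint_left]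
  intro x hx hx'
  refine hkk (funext fun i => ?_)
  have hs := side_pos (⟨j, k⟩ : DyadicCube n)
  have h1 := hx i
  have h2 := hx' i
  have hside : (⟨j, k'⟩ : DyadicCube n).side = (⟨j, k⟩ : DyadicCube n).side := rfl
  rw [hside] at h2
  have h3 : (k i : ℝ) < k' i + 1 := lt_of_mul_lt_mul_right (h1.1.trans_lt h2.2) hs.le
  have h4 : (k' i : ℝ) < k i + 1 := lt_of_mul_lt_mul_right (h2.1.trans_lt h1.2) hs.le
  have h5 : k i < k' i + 1 := by exact_mod_cast h3
  have h6 : k' i < k i + 1 := by exact_mod_cast h4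
  omega

/-- The positions of the dyadic cubes which are `m` generations below `Q₀` and contained in it. -/
def descendants (Q₀ : DyadicCube n) (m : ℕ) : Set (Fin n → ℤ) :=
  {k | (⟨Q₀.gen + m, k⟩ : DyadicCube n).toSet ⊆ Q₀.toSet}

theorem tsum_subset_le_tsum_descendants (hn : 1 ≤ n) (F : DyadicCube n → ℝ≥0∞)
    (Q₀ : DyadicCube n) :
    ∑' Q : {Q : DyadicCube n // Q.toSet ⊆ Q₀.toSet}, F Q.1 ≤
      ∑' m : ℕ, ∑' k : Q₀.descendants m, F ⟨Q₀.gen + m, k⟩ := by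
  let φ : {Q : DyadicCube n // Q.toSet ⊆ Q₀.toSet} → Σ m : ℕ, Q₀.descendants m := fun Q =>
    ⟨(Q.1.gen - Q₀.gen).toNat, Q.1.pos, by
      have h := gen_le_of_subset hn Q.2
      have h1 : Q₀.gen + ((Q.1.gen - Q₀.gen).toNat : ℤ) = Q.1.gen := by omega
      simp only [descendants, Set.mem_ofPred_eq, h1]
      exact Q.2⟩
  let ψ : (Σ m : ℕ, Q₀.descendants m) → DyadicCube n := fun q => ⟨Q₀.gen + q.1, q.2⟩
  have hψφ : ∀ Q, ψ (φ Q) = Q.1 := by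
    intro Q
    have h := gen_le_of_subset hn Q.2
    have h1 : Q₀.gen + ((Q.1.gen - Q₀.gen).toNat : ℤ) = Q.1.gen := by omega
    simp only [ψ, φ, h1]
  have hφ : Function.Injective φ := fun Q Q' h => Subtype.ext (by rw [← hψφ, ← hψφ, h])
  calc ∑' Q : {Q : DyadicCube n // Q.toSet ⊆ Q₀.toSet}, F Q.1 = ∑' Q, F (ψ (φ Q)) := by
        simp_rw [hψφ]
    _ ≤ ∑' q, F (ψ q) := ENNReal.tsum_comp_le_tsum_of_injective hφ _
    _ = _ := ENNReal.tsum_sigma' _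

/-- Bounded overlap of the dilated cubes of one generation, in integrated form. -/
theorem tsum_descendants_setLIntegral_ball_le (hn : 1 ≤ n) {g : EuclideanSpace ℝ (Fin n) → ℝ≥0∞}
    (hg : Measurable g) {R : ℝ} (hR : 0 < R) (Q₀ : DyadicCube n) (m : ℕ) :
    ∑' k : Q₀.descendants m, ∫⁻ z in ball (⟨Q₀.gen + m, k⟩ : DyadicCube n).center
        (R * (Q₀.side / 2 ^ m)), g z ≤
      volume (ball (0 : EuclideanSpace ℝ (Fin n)) (R + √n)) *
        ∫⁻ z in ball Q₀.center ((R + 2 * √n) * Q₀.side), g z := by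
  have hl₀ := Q₀.side_pos
  set l := Q₀.side / 2 ^ m with hl
  have hl0 : 0 < l := by positivity
  have hll : l ≤ Q₀.side := div_le_self hl₀.le (one_le_pow₀ one_le_two)
  let Q : Q₀.descendants m → DyadicCube n := fun k => ⟨Q₀.gen + m, k⟩
  have hside : ∀ k, (Q k).side = l := fun k => side_mk_add _ _ _ Q₀.pos
  have hvol : ∀ k, volume (Q k).toSet = ENNReal.ofReal (l ^ n) := fun k => by
    rw [volume_toSet, hside]
  have hln : ENNReal.ofReal (l ^ n) ≠ 0 := by
    have : 0 < l ^ n := by positivity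
    simpa using this
  have hone : ∀ k, ∫⁻ z in ball (Q k).center (R * l), g z ≤
      (ENNReal.ofReal (l ^ n))⁻¹ *
        ∫⁻ x in (Q k).toSet, ∫⁻ z in ball x ((R + √n) * l), g z := by
    intro k
    rw [← ENNReal.div_eq_inv_mul, ENNReal.le_div_iff_mul_le (Or.inl hln) (Or.inl (by finiteness)),
      ← hvol k, ← setLIntegral_const]
    refine setLIntegral_mono (measurable_setLIntegral_ball hg _) fun x hx => ?_
    refine lintegral_mono_set (ball_subset_ball' ?_)
    have h1 := toSet_subset_ball hn (Q k) hx
    rw [hside, mem_ball'] at h1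
    linarith
  calc ∑' k : Q₀.descendants m, ∫⁻ z in ball (Q k).center (R * l), g z
      ≤ ∑' k : Q₀.descendants m, (ENNReal.ofReal (l ^ n))⁻¹ *
        ∫⁻ x in (Q k).toSet, ∫⁻ z in ball x ((R + √n) * l), g z := by
        gcongr with k
        exact hone k
    _ = (ENNReal.ofReal (l ^ n))⁻¹ *
        ∫⁻ x in ⋃ k, (Q k).toSet, ∫⁻ z in ball x ((R + √n) * l), g z := by
        rw [ENNReal.tsum_mul_left, lintegral_iUnion (fun k => measurableSet_toSet _)]
        intro k k' hkk
        exact pairwise_disjoint_toSet _ fun h => hkk (Subtype.ext h)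
    _ ≤ (ENNReal.ofReal (l ^ n))⁻¹ *
        ∫⁻ x in ball Q₀.center (√n * Q₀.side), ∫⁻ z in ball x ((R + √n) * l), g z := by
        gcongr
        exact Set.iUnion_subset fun k => (show (Q k).toSet ⊆ _ from k.2).trans
          (toSet_subset_ball hn Q₀)
    _ ≤ (ENNReal.ofReal (l ^ n))⁻¹ * (volume (ball (0 : EuclideanSpace ℝ (Fin n)) ((R + √n) * l)) *
        ∫⁻ z in ball Q₀.center (√n * Q₀.side + (R + √n) * l), g z) := by
        gcongr
        exact setLIntegral_setLIntegral_ball_le hg _ _ _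
    _ ≤ (ENNReal.ofReal (l ^ n))⁻¹ * (ENNReal.ofReal (l ^ n) *
        volume (ball (0 : EuclideanSpace ℝ (Fin n)) (R + √n)) *
        ∫⁻ z in ball Q₀.center ((R + 2 * √n) * Q₀.side), g z) := by
        rw [mul_comm (R + √n) l, Measure.addHaar_ball_mul_of_pos _ _ hl0, finrank_euclideanSpace_fin]
        gcongr
        have h1 : l * (R + √n) ≤ Q₀.side * (R + √n) := by gcongr
        linarith
    _ = _ := by
        rw [mul_assoc, ← mul_assoc, ENNReal.inv_mul_cancel hln (by finiteness), one_mul]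

end DyadicCube

/-- Dorronsoro's estimate for `p ≥ 2`, with the condition on the exponent in the form in which the
local estimate produces it. -/
theorem exists_tsum_betaNumber_sq_le {n : ℕ} (hn : 1 ≤ n) {p : ℝ≥0∞} (hp : 2 ≤ p)
    (hε : 0 < 2 - (n : ℝ) + n * (2 / p.toReal)) {C : ℝ} (hC : 1 ≤ C) :
    ∃ K : ℝ≥0, ∀ (L : ℝ≥0) (f : EuclideanSpace ℝ (Fin n) → ℝ), LipschitzWith L f →
      ∀ Q₀ : DyadicCube n,
        ∑' Q : {Q : DyadicCube n // Q.toSet ⊆ Q₀.toSet},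
            betaNumber f p (Q.1.dilate C) ^ 2 * volume Q.1.toSet
          ≤ (K : ℝ≥0∞) * (L : ℝ≥0∞) ^ 2 * volume Q₀.toSet := by
  have hn0 : (0 : ℝ) < n := by exact_mod_cast hn
  have hC0 : 0 < C := by linarith
  have hsqrt : 0 < √(n : ℝ) := Real.sqrt_pos.2 hn0
  set D := √n * C with hD
  have hD0 : 0 < D := by positivity
  obtain ⟨M, hM, hloc⟩ := exists_betaNumber_sq_mul_le hp hε hD0
  set θ : ℝ := (2 : ℝ) ^ (-(2 - n + n * (2 / p.toReal)) / 2) with hθ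
  have hθ0 : 0 < θ := by positivity
  have hθ1 : θ < 1 := Real.rpow_lt_one_of_one_lt_of_neg one_lt_two (by linarith)
  set R := 3 * D + 2 with hR
  have hR0 : 0 < R := by positivity
  set R₁ := R + 2 * √n with hR₁
  set b := volume (ball (0 : EuclideanSpace ℝ (Fin n)) (R + √n)) with hb
  set b₁ := volume (ball (0 : EuclideanSpace ℝ (Fin n)) (D + 1)) with hb₁
  set b₂ := volume (ball (0 : EuclideanSpace ℝ (Fin n)) (R₁ + 3 * (D + 1))) with hb₂
  have hbt : b ≠ ∞ := measure_ball_lt_top.ne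
  have hb₁t : b₁ ≠ ∞ := measure_ball_lt_top.ne
  have hb₂t : b₂ ≠ ∞ := measure_ball_lt_top.ne
  set K : ℝ≥0∞ := M * b * ENNReal.ofReal ((1 - θ)⁻¹) *
    (ENNReal.ofReal (4 * (D + 1) ^ 2) * b₁ * b₂) with hK
  have hKt : K ≠ ∞ := by finiteness
  refine ⟨K.toNNReal, fun L f hf Q₀ => ?_⟩
  rw [ENNReal.coe_toNNReal hKt]
  have hl₀ := Q₀.side_pos
  set l₀ := Q₀.side with hl₀d
  -- the normalized energy density of the second differences at scale `l₀ 2⁻ⁱ`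
  let γ : ℕ → EuclideanSpace ℝ (Fin n) → ℝ≥0∞ := fun i x =>
    ENNReal.ofReal (((l₀ / 2 ^ i) ^ (n + 2))⁻¹) * secondDiffEnergy f ((D + 1) * (l₀ / 2 ^ i)) x
  have hγ : ∀ i, Measurable (γ i) := fun i =>
    (measurable_secondDiffEnergy hf.continuous _).const_mul _
  let I : ℕ → ℝ≥0∞ := fun i => ∫⁻ x in ball Q₀.center (R₁ * l₀), γ i x
  have hcarl : ∑' i, I i ≤ ENNReal.ofReal (4 * (D + 1) ^ 2) * b₁ * b₂ * L ^ 2 *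
      volume Q₀.toSet := by
    have h := tsum_lintegral_secondDiffEnergy_le hf Q₀.center (R := R₁ * l₀) (K := D + 1)
      (by positivity) hl₀
    rw [finrank_euclideanSpace_fin] at h
    refine h.trans_eq ?_
    have h1 : R₁ * l₀ + 3 * ((D + 1) * l₀) = l₀ * (R₁ + 3 * (D + 1)) := by ring
    rw [h1, Measure.addHaar_ball_mul_of_pos _ _ hl₀, finrank_euclideanSpace_fin,
      DyadicCube.volume_toSet]
    ring
  have hcube : ∀ (m : ℕ) (k : Q₀.descendants m),
      betaNumber f p ((⟨Q₀.gen + m, k⟩ : DyadicCube n).dilate C) ^ 2 *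
        volume (⟨Q₀.gen + m, k⟩ : DyadicCube n).toSet ≤
      M * ∑' i : ℕ, ENNReal.ofReal (θ ^ i) *
        ∫⁻ x in ball (⟨Q₀.gen + m, k⟩ : DyadicCube n).center (R * (l₀ / 2 ^ m)), γ (m + i) x := by
    intro m k
    set Q : DyadicCube n := ⟨Q₀.gen + m, k⟩ with hQ
    have hside : Q.side = l₀ / 2 ^ m := DyadicCube.side_mk_add _ _ _ Q₀.pos
    have h := hloc L f hf Q.center Q.side Q.side_pos (Q.dilate C)
      ((axisCube_subset_ball hn _ (mul_pos hC0 Q.side_pos)).trans_eq (by rw [hD, mul_assoc]))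
      (le_trans (ENNReal.ofReal_le_ofReal (le_mul_of_one_le_left Q.side_pos.le hC))
        (ofReal_le_ediam_axisCube hn _))
    rw [← DyadicCube.volume_toSet, hside] at h
    simpa only [γ, div_div, ← pow_add] using h
  have hgen : ∀ m : ℕ, ∑' k : Q₀.descendants m,
      betaNumber f p ((⟨Q₀.gen + m, k⟩ : DyadicCube n).dilate C) ^ 2 *
        volume (⟨Q₀.gen + m, k⟩ : DyadicCube n).toSet ≤
      M * b * ∑' i : ℕ, ENNReal.ofReal (θ ^ i) * I (m + i) := by
    intro m
    refine (ENNReal.tsum_le_tsum (hcube m)).trans ?_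
    rw [ENNReal.tsum_mul_left, ENNReal.tsum_comm, mul_assoc, ← ENNReal.tsum_mul_left (a := b)]
    gcongr with i
    rw [ENNReal.tsum_mul_left, mul_left_comm]
    gcongr
    exact DyadicCube.tsum_descendants_setLIntegral_ball_le hn (hγ _) hR0 Q₀ m
  calc ∑' Q : {Q : DyadicCube n // Q.toSet ⊆ Q₀.toSet},
        betaNumber f p (Q.1.dilate C) ^ 2 * volume Q.1.toSet
      ≤ ∑' m : ℕ, M * b * ∑' i : ℕ, ENNReal.ofReal (θ ^ i) * I (m + i) :=
        (DyadicCube.tsum_subset_le_tsum_descendants hn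
          (fun Q => betaNumber f p (Q.dilate C) ^ 2 * volume Q.toSet) Q₀).trans
          (ENNReal.tsum_le_tsum hgen)
    _ = M * b * ∑' i : ℕ, ENNReal.ofReal (θ ^ i) * ∑' m : ℕ, I (m + i) := by
        rw [ENNReal.tsum_mul_left, ENNReal.tsum_comm]
        simp_rw [ENNReal.tsum_mul_left]
    _ ≤ M * b * ∑' i : ℕ, ENNReal.ofReal (θ ^ i) * ∑' j : ℕ, I j := by
        refine mul_le_mul_right (ENNReal.tsum_le_tsum fun i => mul_le_mul_right ?_ _) _
        exact ENNReal.tsum_comp_le_tsum_of_injective (add_left_injective i) I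
    _ = M * b * (ENNReal.ofReal ((1 - θ)⁻¹) * ∑' j : ℕ, I j) := by
        rw [ENNReal.tsum_mul_right, ← tsum_geometric_of_lt_one hθ0.le hθ1,
          ENNReal.ofReal_tsum_of_nonneg (fun i => by positivity)
            (summable_geometric_of_lt_one hθ0.le hθ1)]
    _ ≤ M * b * (ENNReal.ofReal ((1 - θ)⁻¹) * (ENNReal.ofReal (4 * (D + 1) ^ 2) * b₁ * b₂ * L ^ 2 *
        volume Q₀.toSet)) := by gcongr
    _ = K * L ^ 2 * volume Q₀.toSet := by
        rw [hK]
        ring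

end

theorem theorem1p1 (n : ℕ) (hn : 1 ≤ n) (p : ℝ≥0∞) (hp1 : 1 ≤ p)
    (hp2 : n = 2 → p < ∞)
    (hp3 : 3 ≤ n → p < ENNReal.ofReal (2 * (n : ℝ) / ((n : ℝ) - 2)))
    (C : ℝ) (hC : 1 ≤ C) :
    ∃ K : ℝ≥0, ∀ (L : ℝ≥0) (f : EuclideanSpace ℝ (Fin n) → ℝ), LipschitzWith L f →
      ∀ Q₀ : DyadicCube n,
        ∑' Q : {Q : DyadicCube n // Q.toSet ⊆ Q₀.toSet},
            betaNumber f p (Q.1.dilate C) ^ 2 * volume Q.1.toSet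
          ≤ (K : ℝ≥0∞) * (L : ℝ≥0∞) ^ 2 * volume Q₀.toSet := by
  rcases le_or_gt 2 p with hp | hp
  · refine exists_tsum_betaNumber_sq_le hn hp ?_ hC
    have hpos : p ≠ ∞ → 0 < p.toReal := fun h =>
      ENNReal.toReal_pos (by rintro rfl; simp at hp1) h
    rcases (by omega : n = 1 ∨ n = 2 ∨ 3 ≤ n) with h | h | h
    · subst h
      have : 0 ≤ 2 / p.toReal := by positivity
      push_cast
      linarith
    · have h1 := hpos (hp2 h).ne
      subst h
      have : 0 < 2 / p.toReal := by positivity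
      push_cast
      linarith
    · have h1 := hpos (hp3 h).ne_top
      have hn3 : (3 : ℝ) ≤ n := by exact_mod_cast h
      have h2 := (ENNReal.lt_ofReal_iff_toReal_lt (hp3 h).ne_top).1 (hp3 h)
      rw [lt_div_iff₀ (by linarith)] at h2
      have h3 : (n : ℝ) - 2 < n * (2 / p.toReal) := by
        rw [← mul_div_assoc, lt_div_iff₀ h1]
        linarith
      linarith
  · obtain ⟨K, hK⟩ := exists_tsum_betaNumber_sq_le hn (le_refl 2)
      (by rw [ENNReal.toReal_ofNat]; norm_num) hC
    refine ⟨K, fun L f hf Q₀ => le_trans (ENNReal.tsum_le_tsum fun Q => ?_) (hK L f hf Q₀)⟩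
    gcongr
    refine betaNumber_le_betaNumber_two hf.continuous hp1 hp ?_
    rw [DyadicCube.dilate, volume_axisCube]
    gcongr
    exact ofReal_le_ediam_axisCube hn _
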